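/- Consider the system on $\mathbb{R}^2$ $$\dot x_1 = x_2 + 2\varepsilon\sin x_1,\qquad \dot x_2=-x_1 \qquad (\ast)$$ that is, $\dot x = Ax+\varepsilon g(x)$ with $A=\begin{pmatrix}0&1\\-1&0\end{pmatrix}$ and $g(x)=(2\sin x_1,0)$. A periodic orbit below always means the image of a non-constant periodic solution defined on $\mathbb{R}$. **Notation.** Let $\mathcal{X}_0^\infty(\mathbb{R}^2)$ be the space of $C^\infty$ vector fields on $\mathbb{R}^2$ vanishing at the origin and $\mathcal{L}_A(f)(x)=\frac{\partial f}{\partial x}(x)Ax-Af(x)$. When $\mathcal{X}_0^\infty(\mathbb{R}^2)=\operatorname{Im}\mathcal{L}_A\oplus\operatorname{Ker}\mathcal{L}_A$, let $\mathcal{P}_K$ be the projection onto $\operatorname{Ker}\mathcal{L}_A$ along $\operatorname{Im}\mathcal{L}_A$; the first-order $C^\infty$ normal form of $(\ast)$ is the system $\dot y=Ay+\varepsilon\,\mathcal{P}_K(g)(y)$. Let $x_1=z_1+z_2$, $x_2=i(z_1-z_2)$ be the complex coordinates diagonalizing $A$; polar coordinates $(r,\theta)$, $r>0$, are given by $z_1=re^{i\theta}$,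 $z_2=re^{-i\theta}$, i.e. $x_1=2r\cos\theta$, $x_2=-2r\sin\theta$. Let $J_1(x)=\sum_{k\ge0}\frac{(-1)^k}{k!\,(k+1)!}(x/2)^{2k+1}$ be the Bessel function of the first kind of order one. For polynomial normal forms, expand $\varepsilon g=g_1+g_2+\cdots$ with $g_k(x)=\bigl(2\varepsilon\frac{(-1)^{k-1}}{(2k-1)!}x_1^{2k-1},0\bigr)$ and introduce a bookkeeping parameter $\delta$. A polynomial normal form of order $m$ is a system $\dot z=Az+\delta R_1(z)+\cdots+\delta^mR_m(z)$ with real polynomial vector fields $R_k\in\operatorname{Ker}\mathcal{L}_{A^*}$ vanishing at $0$, for which there are real polynomial vector fields $h_1,\dots,h_m$ vanishing at $0$ such that the substitution $x=z+\delta h_1(z)+\cdots+\delta^mh_m(z)$ transforms $\dot x=Ax+\delta g_1(x)+\cdots+\delta^mg_m(x)$ into it modulo terms of order $\delta^{m+1}$. (The case $\delta=1$ corresponds to $(\ast)$.) **Statement.** 1. $\mathcal{X}_0^\infty(\mathbb{R}^2)=\operatorname{Im}\mathcal{L}_A\oplus\operatorname{Ker}\mathcal{L}_A$, and for every $\varepsilon\in\mathbb{R}$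 the first-order $C^\infty$ normal form of $(\ast)$ in polar coordinates is $$\dot r=\varepsilon J_1(2r),\qquad \dot\theta=1 .$$ For every $\varepsilon>0$ this normal form has infinitely many periodic orbits. 2. The function $r\mapsto J_1(2r)$ has infinitely many zeros $r>0$. 3. There is $\varepsilon_0>0$ such that for every $\varepsilon$ with $0<\varepsilon<\varepsilon_0$ the system $(\ast)$ has infinitely many periodic orbits. 4. Polynomial normal forms do not detect this: for every $\varepsilon>0$, every $m\ge1$ and every $\delta>0$ (in particular $\delta=1$), every polynomial normal form of order $m$ has only finitely many periodic orbits. -/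

import Mathlib

open scoped ContDiff Matrix Topology

noncomputable section

namespace SmoothNormalForm

/-! ### Smooth vector fields vanishing at the origin and the operator `𝓛_A` -/

/-- The operator `𝓛_A(f)(x) = (∂f/∂x)(x) A x - A f(x)` on vector fields of `ℝⁿ`. -/
def homological {n : ℕ} (A : Matrix (Fin n) (Fin n) ℝ) (f : (Fin n → ℝ) → (Fin n → ℝ)) :
    (Fin n → ℝ) → (Fin n → ℝ) :=
  fun x => fderiv ℝ f x (A *ᵥ x) - A *ᵥ f x

/-- The space `𝒳₀^∞(ℝⁿ)` of `C^∞` vector fields on `ℝⁿ` that vanish at the origin. -/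
def smoothFields (n : ℕ) : Submodule ℝ ((Fin n → ℝ) → (Fin n → ℝ)) where
  carrier := {f | ContDiff ℝ ∞ f ∧ f 0 = 0}
  zero_mem' := ⟨contDiff_const, rfl⟩
  add_mem' := by
    rintro f g ⟨hf, hf0⟩ ⟨hg, hg0⟩
    exact ⟨hf.add hg, by simp [hf0, hg0]⟩
  smul_mem' := by
    rintro c f ⟨hf, hf0⟩
    exact ⟨hf.const_smul c, by simp [hf0]⟩

theorem contDiff_mulVec {n : ℕ} (A : Matrix (Fin n) (Fin n) ℝ) :
    ContDiff ℝ ∞ (fun x : Fin n → ℝ => A *ᵥ x) :=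
  (LinearMap.toContinuousLinearMap (Matrix.mulVecLin A)).contDiff

theorem homological_mem {n : ℕ} (A : Matrix (Fin n) (Fin n) ℝ)
    {f : (Fin n → ℝ) → (Fin n → ℝ)} (hf : f ∈ smoothFields n) :
    homological A f ∈ smoothFields n := by
  obtain ⟨hs, h0⟩ := hf
  refine ⟨?_, by simp [homological, h0]⟩
  have h1 : ContDiff ℝ ∞ (fderiv ℝ f) := hs.fderiv_right (by simp)
  exact (h1.clm_apply (contDiff_mulVec A)).sub ((contDiff_mulVec A).comp hs)

/-- `𝓛_A` as a linear map `𝒳₀^∞(ℝⁿ) → 𝒳₀^∞(ℝⁿ)`. -/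
def homologicalOp {n : ℕ} (A : Matrix (Fin n) (Fin n) ℝ) :
    smoothFields n →ₗ[ℝ] smoothFields n where
  toFun f := ⟨homological A f, homological_mem A f.2⟩
  map_add' := by
    rintro ⟨f, hf⟩ ⟨g, hg⟩
    ext1
    funext x
    have h1 : DifferentiableAt ℝ f x := hf.1.differentiable (by simp) x
    have h2 : DifferentiableAt ℝ g x := hg.1.differentiable (by simp) x
    simp only [homological, Submodule.coe_add, Pi.add_apply, fderiv_add h1 h2,
      add_apply, Matrix.mulVec_add]
    abel
  map_smul' := by
    rintro c ⟨f, hf⟩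
    ext1
    funext x
    have h1 : DifferentiableAt ℝ f x := hf.1.differentiable (by simp) x
    simp only [homological, Submodule.coe_smul, Pi.smul_apply, fderiv_const_smul h1,
      smul_apply, Matrix.mulVec_smul, smul_sub, RingHom.id_apply]

/-- `V_I = Im 𝓛_A`. -/
def imageSpace {n : ℕ} (A : Matrix (Fin n) (Fin n) ℝ) : Submodule ℝ (smoothFields n) :=
  LinearMap.range (homologicalOp A)

/-- `V_K = Ker 𝓛_A`. -/
def kernelSpace {n : ℕ} (A : Matrix (Fin n) (Fin n) ℝ) : Submodule ℝ (smoothFields n) :=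
  LinearMap.ker (homologicalOp A)

/-- The projection `𝒫_K` onto `V_K` along `V_I`, when `𝒳₀^∞(ℝⁿ) = V_I ⊕ V_K`. -/
def projKernel {n : ℕ} (A : Matrix (Fin n) (Fin n) ℝ)
    (hA : IsCompl (imageSpace A) (kernelSpace A)) : smoothFields n →ₗ[ℝ] smoothFields n :=
  (kernelSpace A).projection (imageSpace A) hA.symm

/-- The right-hand side `A z + ε 𝒫_K(g)(z)` of the first-order `C^∞` normal form of
`ẋ = A x + ε g(x)`. -/
def firstOrderNormalForm {n : ℕ} (A : Matrix (Fin n) (Fin n) ℝ)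
    (hA : IsCompl (imageSpace A) (kernelSpace A)) (g : smoothFields n) (ε : ℝ) :
    (Fin n → ℝ) → (Fin n → ℝ) :=
  fun z => A *ᵥ z + ε • (projKernel A hA g : (Fin n → ℝ) → (Fin n → ℝ)) z

/-! ### Periodic orbits -/

/-- The set of (non-constant) periodic orbits of `ẋ = F(x)`, as subsets of phase space. -/
def periodicOrbits {n : ℕ} (F : (Fin n → ℝ) → (Fin n → ℝ)) : Set (Set (Fin n → ℝ)) :=
  {C | ∃ (γ : ℝ → Fin n → ℝ) (T : ℝ), 0 < T ∧ (∀ t, HasDerivAt γ (F (γ t)) t) ∧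
    (∀ t, γ (t + T) = γ t) ∧ (∃ t, γ t ≠ γ 0) ∧ C = Set.range γ}

/-! ### Polynomial normal forms -/

/-- A polynomial vector field vanishing at the origin. -/
def IsPolynomialField {n : ℕ} (f : (Fin n → ℝ) → (Fin n → ℝ)) : Prop :=
  (∃ P : Fin n → MvPolynomial (Fin n) ℝ, ∀ x i, f x i = MvPolynomial.eval x (P i)) ∧ f 0 = 0

/-- The vector field `A x + δ g₀(x) + δ² g₁(x) + ⋯ + δᵐ gₘ₋₁(x)`. -/
def truncatedField {n : ℕ} (A : Matrix (Fin n) (Fin n) ℝ)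
    (g : ℕ → (Fin n → ℝ) → (Fin n → ℝ)) (m : ℕ) (δ : ℝ) : (Fin n → ℝ) → (Fin n → ℝ) :=
  fun x => A *ᵥ x + ∑ k ∈ Finset.range m, δ ^ (k + 1) • g k x

/-- The near identity transformation `z + δ h₀(z) + δ² h₁(z) + ⋯ + δᵐ hₘ₋₁(z)`. -/
def nearIdentity {n : ℕ} (h : ℕ → (Fin n → ℝ) → (Fin n → ℝ)) (m : ℕ) (δ : ℝ) :
    (Fin n → ℝ) → (Fin n → ℝ) :=
  fun z => z + ∑ k ∈ Finset.range m, δ ^ (k + 1) • h k z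

/-- `ż = A z + δ R₀(z) + ⋯ + δᵐ Rₘ₋₁(z)` is an `m`-th order polynomial normal form of
`ẋ = A x + δ g₀(x) + ⋯ + δᵐ gₘ₋₁(x) + ⋯`: the `R_k` are polynomial and lie in `Ker 𝓛_{A*}`, and
a polynomial near identity transformation `x = z + δ h₀(z) + ⋯ + δᵐ hₘ₋₁(z)` transforms the
second system into the first one modulo terms of order `δᵐ⁺¹`. -/
def IsPolynomialNormalForm {n : ℕ} (A : Matrix (Fin n) (Fin n) ℝ)
    (g : ℕ → (Fin n → ℝ) → (Fin n → ℝ)) (m : ℕ) (R : ℕ → (Fin n → ℝ) → (Fin n → ℝ)) : Prop :=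
  (∀ k < m, IsPolynomialField (R k) ∧ homological Aᵀ (R k) = 0) ∧
  ∃ h : ℕ → (Fin n → ℝ) → (Fin n → ℝ), (∀ k < m, IsPolynomialField (h k)) ∧
    ∀ z, (fun δ : ℝ => fderiv ℝ (nearIdentity h m δ) z (truncatedField A R m δ z)
        - truncatedField A g m δ (nearIdentity h m δ z)) =O[𝓝 0] fun δ : ℝ => δ ^ (m + 1)

/-! ### The Bessel function -/

/-- The Bessel function of the first kind `J_ν` of integer order `ν ≥ 0`. -/
def besselJ (ν : ℕ) (x : ℝ) : ℝ :=
  ∑' k : ℕ, (-1) ^ k / ((k.factorial : ℝ) * ((k + ν).factorial : ℝ)) * (x / 2) ^ (2 * k + ν)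

/-! ### The system `ẋ₁ = x₂ + 2 ε sin x₁`, `ẋ₂ = -x₁` -/

/-- The right-hand side of the system. -/
def exampleField (ε : ℝ) : (Fin 2 → ℝ) → (Fin 2 → ℝ) :=
  fun x => ![x 1 + 2 * ε * Real.sin (x 0), -x 0]

/-- The linear part of the system at `ε = 0`. -/
def exampleMatrix : Matrix (Fin 2) (Fin 2) ℝ := !![0, 1; -1, 0]

/-- The perturbation `(2 sin x₁, 0)`. -/
def examplePerturbation : smoothFields 2 :=
  ⟨fun x => ![2 * Real.sin (x 0), 0], by
    refine ⟨contDiff_pi.2 fun i => ?_, ?_⟩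
    · fin_cases i
      · exact contDiff_const.mul (Real.contDiff_sin.comp (contDiff_apply ℝ ℝ (0 : Fin 2)))
      · exact contDiff_const
    · ext i
      fin_cases i <;> simp⟩

theorem exampleField_eq (ε : ℝ) (x : Fin 2 → ℝ) :
    exampleField ε x = exampleMatrix *ᵥ x
      + ε • (examplePerturbation : (Fin 2 → ℝ) → (Fin 2 → ℝ)) x := by
  ext i
  fin_cases i <;>
    simp [exampleField, exampleMatrix, examplePerturbation, dotProduct,
      Fin.sum_univ_two]
  ring

/-- The coordinate `z₁` of the diagonalizing coordinates `x₁ = z₁ + z₂`, `x₂ = i (z₁ - z₂)`; on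
`ℝ²` the coordinate `z₂` is its complex conjugate. -/
def diagCoord (x : Fin 2 → ℝ) : ℂ := ((x 0 : ℂ) - Complex.I * (x 1 : ℂ)) / 2

theorem diagCoord_spec (x : Fin 2 → ℝ) :
    (x 0 : ℂ) = diagCoord x + (starRingEnd ℂ) (diagCoord x) ∧
      (x 1 : ℂ) = Complex.I * (diagCoord x - (starRingEnd ℂ) (diagCoord x)) := by
  have h2 : (starRingEnd ℂ) 2 = 2 := Complex.conj_ofNat 2
  constructor
  · simp [diagCoord, h2]
    ring
  · simp [diagCoord, h2]
    ring_nf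
    simp

/-- In the diagonalizing coordinates the system is `ż₁ = i z₁ + ε sin (z₁ + z₂)` (together with
the complex conjugate equation for `z₂`). -/
theorem diagCoord_exampleField (ε : ℝ) (x : Fin 2 → ℝ) :
    diagCoord (exampleField ε x) = Complex.I * diagCoord x
      + ε * Complex.sin (diagCoord x + (starRingEnd ℂ) (diagCoord x)) := by
  rw [← (diagCoord_spec x).1]
  simp [diagCoord, exampleField]
  ring_nf
  simp
  ring

/-- The point of `ℝ²` with polar coordinates `z₁ = r e^{iθ}`, `z₂ = r e^{-iθ}`. -/
def polarPoint (r θ : ℝ) : Fin 2 → ℝ := ![2 * r * Real.cos θ, -(2 * r * Real.sin θ)]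

theorem diagCoord_polarPoint (r θ : ℝ) :
    diagCoord (polarPoint r θ) = r * Complex.exp (θ * Complex.I) := by
  rw [Complex.exp_mul_I]
  simp [diagCoord, polarPoint]
  ring

/-- The homogeneous terms `(2 ε (-1)ᵏ x₁²ᵏ⁺¹ / (2k+1)!, 0)`, `k = 0, 1, 2, …`, of the Taylor
expansion of the perturbation `(2 ε sin x₁, 0)`. -/
def exampleTaylorTerm (ε : ℝ) (k : ℕ) : (Fin 2 → ℝ) → (Fin 2 → ℝ) :=
  fun x => ![2 * ε * ((-1) ^ k * x 0 ^ (2 * k + 1) / ((2 * k + 1).factorial : ℝ)), 0]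

end SmoothNormalForm

end

/-! The flow of `exampleMatrix` is `2π`-periodic, so vector fields can be averaged over it.
Transport along the flow satisfies `d/dt (e^{-tA} f e^{tA}) = e^{-tA} 𝓛_A(f) e^{tA}`. Hence the
average kills the image of `𝓛_A`, fixes its kernel and takes values there, while the mean weighted
by `t` solves `𝓛_A h = f - average f`. This gives the splitting and identifies `projKernel` with
`average` (`projKernel_eq_average`). Averaging `(2 sin x₁, 0)` produces the integral representation
of `J₁`, and zeros of `J₁(2r)` are invariant circles.

Parts 2 and 3 rest on one sign lemma, `integral_mul_cos_sign_of_hasDerivAt`. Let `η` be the height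
over the `x₁`-axis of a quarter turn ending at `((n+1)π, 0)`. The half-waves of `∫ η cos` alternate
in sign and grow in size, so the last one decides the sign `(-1)^n`. For the circle (`e = 0`) the
integral is a positive multiple of `J₁((n+1)π)`. For a true trajectory it gives the energy change
over the quarter turn, so the radial drift over the half turn through `((n+1)π, 0)` also has sign
`(-1)^n`. In both cases the intermediate value theorem gives a zero between consecutive multiples of
`π`. The field is odd, so a half turn with equal end radii closes to a periodic orbit. All estimates
are uniform in `n`, whence the single bound `ε₀ = 1/10`.

For part 4, `A* = -A`, so the polynomial normal form is rotation equivariant and its radius obeys a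
scalar polynomial equation; a periodic orbit is then a circle whose radius is a root, unless that
polynomial vanishes. It does not vanish: a near identity change preserves the trace of the linear
part modulo `δ^{m+1}` (`jacobian_trace_eq_of_normalForm`), so the radial polynomial has linear
coefficient `δε`. -/

namespace SmoothNormalForm

/-! ### Signs of oscillatory integrals against the cosine -/

section AlternatingIntegrals

open Real Set

/-- An alternating sum of positive increasing terms has the sign of its last term. -/
theorem alternating_sum_sign {a : ℕ → ℝ} (n : ℕ) (h0 : 0 < a 0)
    (ha : ∀ k < n, a k < a (k + 1)) :
    0 < (-1) ^ n * ∑ k ∈ Finset.range (n + 1), (-1) ^ k * a k ∧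
      (-1) ^ n * ∑ k ∈ Finset.range (n + 1), (-1) ^ k * a k ≤ a n := by
  induction n with
  | zero => simp [h0]
  | succ n ih =>
    obtain ⟨h1, h2⟩ := ih fun k hk => ha k (by omega)
    have h3 := ha n (by omega)
    have h4 : ((-1 : ℝ) ^ (n + 1)) * (-1) ^ (n + 1) = 1 := by
      rw [← mul_pow]; simp
    rw [Finset.sum_range_succ, mul_add, ← mul_assoc ((-1 : ℝ) ^ (n + 1)) ((-1) ^ (n + 1)), h4,
      pow_succ]
    constructor <;> linarith

/-- Each half-wave is folded at its midpoint with `cos (π - x) = -cos x`. Only differences of `η`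
remain, weighted by a nonnegative cosine. -/
theorem integral_mul_cos_half_wave {η : ℝ → ℝ} (hη : Continuous η) (k : ℕ) :
    ∫ x in (k * π)..((k + 1 : ℕ) * π), η x * cos x =
      (-1) ^ k * ∫ x in (0 : ℝ)..(π / 2), (η (k * π + x) - η (k * π + (π - x))) * cos x := by
  have h1 : ∫ x in (k * π)..((k + 1 : ℕ) * π), η x * cos x =
      ∫ x in (0 : ℝ)..π, η (k * π + x) * cos (k * π + x) := by
    rw [intervalIntegral.integral_comp_add_left (fun x => η x * cos x)]
    congr 1 <;> push_cast <;> ring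
  have h2 : ∀ x, η (k * π + x) * cos (k * π + x) = (-1) ^ k * (η (k * π + x) * cos x) := by
    intro x
    rw [add_comm (k * π) x, cos_add_nat_mul_pi]
    ring
  have h3 : ∫ x in (π / 2)..π, η (k * π + x) * cos x =
      ∫ x in (0 : ℝ)..(π / 2), -(η (k * π + (π - x)) * cos x) := by
    have := intervalIntegral.integral_comp_sub_left (fun x => η (k * π + x) * cos x) π
      (a := 0) (b := π / 2)
    rw [show π - π / 2 = π / 2 by ring, sub_zero] at this
    rw [← this]
    congr 1
    ext x
    rw [cos_pi_sub]
    ring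
  rw [h1]
  simp only [h2]
  rw [intervalIntegral.integral_const_mul, ← intervalIntegral.integral_add_adjacent_intervals
    (b := π / 2), h3, ← intervalIntegral.integral_add]
  · congr 2
    ext x
    ring
  all_goals exact Continuous.intervalIntegrable (by fun_prop) _ _

/-- If `η` decreases, at an increasing rate when compared at distance `π`, then the last
half-wave decides the sign of `∫ η cos`. -/
theorem integral_mul_cos_sign {η : ℝ → ℝ} (n : ℕ) (hη : Continuous η)
    (ha : StrictAntiOn η (Icc 0 ((n + 1) * π)))
    (hg : StrictMonoOn (fun x => η x - η (x + π)) (Icc 0 (n * π))) :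
    0 < (-1) ^ n * ∫ x in (0 : ℝ)..((n + 1) * π), η x * cos x := by
  set a : ℕ → ℝ := fun k =>
    ∫ x in (0 : ℝ)..(π / 2), (η (k * π + x) - η (k * π + (π - x))) * cos x with ha_def
  have hpi := pi_pos
  have hsum : ∫ x in (0 : ℝ)..((n + 1) * π), η x * cos x =
      ∑ k ∈ Finset.range (n + 1), (-1) ^ k * a k := by
    have := intervalIntegral.sum_integral_adjacent_intervals (f := fun x => η x * cos x)
      (a := fun k : ℕ => (k : ℝ) * π) (n := n + 1) (μ := MeasureTheory.volume)
      fun k _ => Continuous.intervalIntegrable (by fun_prop) _ _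
    simp only [integral_mul_cos_half_wave hη] at this
    rw [this]
    simp
  rw [hsum]
  refine (alternating_sum_sign n ?_ ?_).1
  · have : ∫ x in (0 : ℝ)..(π / 2), (0 : ℝ) < a 0 := by
      refine intervalIntegral.integral_lt_integral_of_continuousOn_of_le_of_exists_lt (by positivity)
        (by fun_prop) (by fun_prop) ?_ ⟨0, ⟨le_rfl, by positivity⟩, ?_⟩
      · intro x hx
        have h1 : η (0 * π + (π - x)) ≤ η (0 * π + x) := by
          refine ha.antitoneOn ?_ ?_ ?_
          · constructor <;> nlinarith [hx.1, hx.2]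
          · constructor <;> nlinarith [hx.1, hx.2]
          · linarith [hx.2]
        have h2 := cos_nonneg_of_mem_Icc (x := x) ⟨by linarith [hx.1], hx.2⟩
        simpa using mul_nonneg (sub_nonneg.2 h1) h2
      · have h1 : η (0 * π + (π - 0)) < η (0 * π + 0) := by
          refine ha ?_ ?_ ?_
          · constructor <;> nlinarith
          · constructor <;> nlinarith
          · linarith
        simpa using h1
    simpa using this
  · intro k hk
    have hk' : (k : ℝ) + 1 ≤ n := by exact_mod_cast hk
    have key : ∀ x ∈ Icc (0 : ℝ) (π / 2), x < π / 2 → η (k * π + x) - η (k * π + (π - x)) <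
        η ((k + 1 : ℕ) * π + x) - η ((k + 1 : ℕ) * π + (π - x)) := by
      intro x hx hx'
      -- Growth of the gap `η y - η (y + π)` between mirror points is, after rearrangement, growth
      -- of the folded integrand from one half-wave to the next.
      have h1 := hg (a := k * π + x) (b := k * π + (π - x))
        ⟨by nlinarith [hx.1, hx.2, (Nat.cast_nonneg k : (0 : ℝ) ≤ k)], by nlinarith [hx.1, hx.2]⟩
        ⟨by nlinarith [hx.1, hx.2, (Nat.cast_nonneg k : (0 : ℝ) ≤ k)], by nlinarith [hx.1, hx.2]⟩
        (by linarith)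
      have e1 : ((k + 1 : ℕ) : ℝ) * π + x = k * π + x + π := by push_cast; ring
      have e2 : ((k + 1 : ℕ) : ℝ) * π + (π - x) = k * π + (π - x) + π := by push_cast; ring
      rw [e1, e2]
      simp only at h1
      linarith
    refine intervalIntegral.integral_lt_integral_of_continuousOn_of_le_of_exists_lt (by positivity)
      (by fun_prop) (by fun_prop) ?_ ⟨0, ⟨le_rfl, by positivity⟩, ?_⟩
    · intro x hx
      have h2 := cos_nonneg_of_mem_Icc (x := x) ⟨by linarith [hx.1], hx.2⟩
      rcases hx.2.lt_or_eq with h | h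
      · exact mul_le_mul_of_nonneg_right (key x ⟨hx.1.le, hx.2⟩ h).le h2
      · rw [h]; simp
    · have := key 0 ⟨le_rfl, by positivity⟩ (by positivity)
      simpa using this

/-- The sign of `∫ η cos` along a quarter turn `η' = - x / (η - 2 e sin x)` which ends at
`((n + 1) π, 0)`. -/
theorem integral_mul_cos_sign_of_hasDerivAt {η : ℝ → ℝ} {e : ℝ} (n : ℕ) (he : |e| ≤ 1 / 10)
    (hη : Continuous η)
    (hpos : ∀ x ∈ Ioo 0 ((n + 1) * π), 0 < η x)
    (hden : ∀ x ∈ Ioo 0 ((n + 1) * π), 0 < η x - 2 * e * sin x)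
    (hderiv : ∀ x ∈ Ioo 0 ((n + 1) * π), HasDerivAt η (-(x / (η x - 2 * e * sin x))) x) :
    0 < (-1) ^ n * ∫ x in (0 : ℝ)..((n + 1) * π), η x * cos x := by
  have hpi := pi_gt_three
  obtain ⟨he1, he2⟩ := abs_le.1 he
  have hanti : StrictAntiOn η (Icc 0 ((n + 1) * π)) := by
    refine strictAntiOn_of_deriv_neg (convex_Icc _ _) hη.continuousOn fun x hx => ?_
    rw [interior_Icc] at hx
    rw [(hderiv x hx).deriv]
    have := div_pos hx.1 (hden x hx)
    linarith
  refine integral_mul_cos_sign n hη hanti ?_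
  refine strictMonoOn_of_deriv_pos (convex_Icc _ _) (by fun_prop) fun x hx => ?_
  rw [interior_Icc] at hx
  have hx1 : x ∈ Ioo 0 ((n + 1) * π) := ⟨hx.1, by linarith [hx.2]⟩
  have hx2 : x + π ∈ Ioo 0 ((n + 1) * π) := ⟨by linarith [hx.1], by linarith [hx.2]⟩
  have hd := (hderiv x hx1).sub ((hderiv _ hx2).comp_add_const x π)
  rw [show deriv (fun x => η x - η (x + π)) x = _ from hd.deriv, sin_add_pi]
  -- the mean value inequality for `η`
  have hslope : ∀ p q, x ≤ p → p < q → q ≤ x + π → p * (q - p) ≤ (η x + 1 / 5) * (η p - η q) := by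
    intro p q hxp hpq hq
    obtain ⟨c, hc, hc'⟩ := exists_hasDerivAt_eq_slope η _ hpq hη.continuousOn
      fun c hc => hderiv c ⟨by linarith [hc.1, hx.1], by linarith [hc.2, hx2.2]⟩
    have hcm : c ∈ Ioo 0 ((n + 1) * π) := ⟨by linarith [hc.1, hx.1], by linarith [hc.2, hx2.2]⟩
    have hcx : η c ≤ η x := hanti.antitoneOn (Ioo_subset_Icc_self hx1) (Ioo_subset_Icc_self hcm)
      (by linarith [hc.1])
    have hs := abs_le.1 (abs_sin_le_one c)
    have hes : -(1 / 10) ≤ e * sin c := by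
      rcases le_total 0 e with h | h <;> nlinarith
    have hd0 := hden c hcm
    rw [eq_div_iff (by linarith), neg_mul, div_mul_eq_mul_div, ← neg_div, div_eq_iff hd0.ne'] at hc'
    have : η q ≤ η p := by
      by_contra! hcon
      nlinarith [mul_pos (sub_pos.2 hcon) hd0, mul_pos hcm.1 (sub_pos.2 hpq)]
    nlinarith [mul_nonneg (sub_nonneg.2 this) (by linarith : (0 : ℝ) ≤ η x + 1 / 5 - (η c - 2 * e * sin c)),
      mul_pos (sub_pos.2 hc.1) (sub_pos.2 hpq)]
  have hx0 := hx.1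
  -- After clearing denominators the claim is `(2π + 4x) e sin x < x (Y - η (x + π)) + π Y`. With
  -- `|e sin x| ≤ 1/10` it suffices to bound `Y` and the drop `Y - η (x + π)` from below.
  set Y := η x with hY
  have hY0 : 0 < Y := hpos x hx1
  have hYp := hpos _ hx2
  have hY1 : 1 ≤ Y := by
    have h1 := hslope (x + π / 2) (x + π) (by linarith) (by linarith) le_rfl
    have h2 : η (x + π / 2) ≤ Y := hanti.antitoneOn (Ioo_subset_Icc_self hx1)
      ⟨by linarith, by linarith [hx2.2]⟩ (by linarith)
    by_contra! hcon
    nlinarith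
  have hdrop := hslope x (x + π) le_rfl (by linarith) le_rfl
  rw [add_sub_cancel_left] at hdrop
  have hs := abs_le.1 (abs_sin_le_one x)
  have hes : |e * sin x| ≤ 1 / 10 := by
    rw [abs_mul]
    nlinarith [abs_nonneg e, abs_sin_le_one x, abs_nonneg (sin x)]
  obtain ⟨hes1, hes2⟩ := abs_le.1 hes
  have hd1 := hden _ hx1
  have hd2 := hden _ hx2
  rw [sin_add_pi] at hd2
  rw [neg_sub_neg, sub_pos, div_lt_div_iff₀ hd1 hd2]
  have hU : 0 < Y + 1 / 5 := by linarith
  have hD : π * x ^ 2 ≤ (Y + 1 / 5) * (x * (Y - η (x + π))) := by nlinarith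
  -- The target times `Y + 1/5`, with the drop replaced by its lower bound `π x / (Y + 1/5)`. Since
  -- `Y ≥ 1`, this is a definite quadratic inequality in `x` and `Y + 1/5`.
  have hkey : (2 * π + 4 * x) * (1 / 10) * (Y + 1 / 5) < π * x ^ 2 + π * Y * (Y + 1 / 5) := by
    have h1 : 2 / 3 * (Y + 1 / 5) ^ 2 ≤ (Y - 1 / 5) * (Y + 1 / 5) := by nlinarith
    have h2 : 0 ≤ (π - 3) * ((Y - 1 / 5) * (Y + 1 / 5)) :=
      mul_nonneg (by linarith) (mul_nonneg (by linarith) hU.le)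
    have h3 : 0 ≤ (π - 3) * x ^ 2 := mul_nonneg (by linarith) (sq_nonneg x)
    nlinarith [sq_nonneg (x - (Y + 1 / 5)), sq_pos_of_pos hU]
  have : (2 * π + 4 * x) * (1 / 10) < x * (Y - η (x + π)) + π * Y := by
    by_contra! hcon
    nlinarith
  nlinarith [mul_nonneg (by positivity : 0 ≤ 2 * π + 4 * x) (by linarith : 0 ≤ 1 / 10 - e * sin x)]

end AlternatingIntegrals

/-! ### Smooth dependence of integrals on parameters -/

section ParametricIntegral

open MeasureTheory Set

variable {E F : Type} [NormedAddCommGroup E] [NormedSpace ℝ E] [ProperSpace E]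
  [NormedAddCommGroup F] [NormedSpace ℝ F]

theorem hasFDerivAt_intervalIntegral_of_contDiff {f : ℝ × E → F} (hf : ContDiff ℝ 1 f) (a b : ℝ)
    (x : E) :
    HasFDerivAt (fun x => ∫ t in a..b, f (t, x))
      (∫ t in a..b, (fderiv ℝ f (t, x)).comp (ContinuousLinearMap.inr ℝ ℝ E)) x := by
  have hc : Continuous fun p : ℝ × E =>
      (fderiv ℝ f p).comp (ContinuousLinearMap.inr ℝ ℝ E) :=
    (hf.continuous_fderiv one_ne_zero).clm_comp continuous_const
  obtain ⟨C, hC⟩ := ((isCompact_uIcc (a := a) (b := b)).prod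
    (isCompact_closedBall x 1)).exists_bound_of_continuousOn hc.continuousOn
  refine intervalIntegral.hasFDerivAt_integral_of_dominated_of_fderiv_le (bound := fun _ => C)
    (F' := fun x t => (fderiv ℝ f (t, x)).comp (ContinuousLinearMap.inr ℝ ℝ E))
    (Metric.closedBall_mem_nhds x one_pos) ?_ ?_ ?_ ?_ ?_ ?_
  · exact Filter.Eventually.of_forall fun y => Continuous.aestronglyMeasurable
      (hf.continuous.comp (by fun_prop : Continuous fun t : ℝ => (t, y)))
  · exact (hf.continuous.comp (by fun_prop : Continuous fun t : ℝ => (t, x))).intervalIntegrable _ _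
  · exact Continuous.aestronglyMeasurable
      (hc.comp (by fun_prop : Continuous fun t : ℝ => (t, x)))
  · exact Filter.Eventually.of_forall fun t ht y hy => hC (t, y) ⟨uIoc_subset_uIcc ht, hy⟩
  · simp
  · refine Filter.Eventually.of_forall fun t _ y _ => ?_
    have h1 : HasFDerivAt (fun y : E => ((t, y) : ℝ × E)) (ContinuousLinearMap.inr ℝ ℝ E) y :=
      hasFDerivAt_prodMk_right t y
    exact ((hf.differentiable one_ne_zero (t, y)).hasFDerivAt).comp y h1

/-- The target space is quantified inside the induction because the derivative of the integrand
takes values in `E →L[ℝ] F`. -/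
theorem contDiff_intervalIntegral_nat (n : ℕ) : ∀ {F : Type} [NormedAddCommGroup F]
    [NormedSpace ℝ F] {f : ℝ × E → F}, ContDiff ℝ ∞ f → ∀ a b : ℝ,
    ContDiff ℝ n (fun x => ∫ t in a..b, f (t, x)) := by
  induction n with
  | zero =>
    intro F _ _ f hf a b
    rw [Nat.cast_zero, contDiff_zero]
    exact intervalIntegral.continuous_parametric_intervalIntegral_of_continuous'
      (f := fun x t => f (t, x)) (hf.continuous.comp continuous_swap) a b
  | succ n ih =>
    intro F _ _ f hf a b
    rw [Nat.cast_add, Nat.cast_one, contDiff_succ_iff_hasFDerivAt]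
    refine ⟨_, ?_, fun x => hasFDerivAt_intervalIntegral_of_contDiff (hf.of_le (by simp)) a b x⟩
    exact ih (f := fun p => (fderiv ℝ f p).comp (ContinuousLinearMap.inr ℝ ℝ E))
      ((hf.fderiv_right (by simp)).clm_comp contDiff_const) a b

/-- Integrals of smooth functions depend smoothly on parameters. -/
theorem contDiff_intervalIntegral {f : ℝ × E → F} (hf : ContDiff ℝ ∞ f) (a b : ℝ) :
    ContDiff ℝ ∞ (fun x => ∫ t in a..b, f (t, x)) :=
  contDiff_infty.2 fun n => contDiff_intervalIntegral_nat n hf a b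

end ParametricIntegral

/-! ### Averaging over the linear flow and the splitting into image and kernel -/

section Averaging

open Real MeasureTheory

/-- The flow `x ↦ e^{tA} x` of the linear part. -/
noncomputable def rot (t : ℝ) (x : Fin 2 → ℝ) : Fin 2 → ℝ := cos t • x + sin t • (exampleMatrix *ᵥ x)

theorem exampleMatrix_mulVec_mulVec (x : Fin 2 → ℝ) :
    exampleMatrix *ᵥ (exampleMatrix *ᵥ x) = -x := by
  ext i
  fin_cases i <;> simp [exampleMatrix, dotProduct, Fin.sum_univ_two]

theorem exampleMatrix_transpose : exampleMatrixᵀ = -exampleMatrix := by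
  ext i j
  fin_cases i <;> fin_cases j <;> simp [exampleMatrix]

@[simp]
theorem rot_zero (x : Fin 2 → ℝ) : rot 0 x = x := by simp [rot]

@[simp]
theorem rot_two_pi (x : Fin 2 → ℝ) : rot (2 * π) x = x := by simp [rot]

@[simp]
theorem rot_neg_two_pi (x : Fin 2 → ℝ) : rot (-(2 * π)) x = x := by simp [rot]

@[simp]
theorem rot_apply_zero (t : ℝ) : rot t 0 = 0 := by simp [rot]

theorem rot_rot (s t : ℝ) (x : Fin 2 → ℝ) : rot s (rot t x) = rot (s + t) x := by
  simp only [rot, cos_add, sin_add, Matrix.mulVec_add, Matrix.mulVec_smul,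
    exampleMatrix_mulVec_mulVec]
  module

@[simp]
theorem rot_neg_rot (t : ℝ) (x : Fin 2 → ℝ) : rot (-t) (rot t x) = x := by simp [rot_rot]

@[simp]
theorem rot_rot_neg (t : ℝ) (x : Fin 2 → ℝ) : rot t (rot (-t) x) = x := by simp [rot_rot]

theorem rot_add_vec (t : ℝ) (x y : Fin 2 → ℝ) : rot t (x + y) = rot t x + rot t y := by
  simp only [rot, Matrix.mulVec_add]
  module

theorem rot_smul (t c : ℝ) (x : Fin 2 → ℝ) : rot t (c • x) = c • rot t x := by
  simp only [rot, Matrix.mulVec_smul]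
  module

theorem rot_sub_vec (t : ℝ) (x y : Fin 2 → ℝ) : rot t (x - y) = rot t x - rot t y := by
  simp only [rot, Matrix.mulVec_sub]
  module

theorem exampleMatrix_mulVec_rot (t : ℝ) (x : Fin 2 → ℝ) :
    exampleMatrix *ᵥ rot t x = rot t (exampleMatrix *ᵥ x) := by
  simp only [rot, Matrix.mulVec_add, Matrix.mulVec_smul]

/-- `rot t` as a continuous linear map. -/
noncomputable def rotCLM (t : ℝ) : (Fin 2 → ℝ) →L[ℝ] (Fin 2 → ℝ) :=
  LinearMap.toContinuousLinearMap
    { toFun := rot t, map_add' := rot_add_vec t, map_smul' := rot_smul t }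

theorem hasDerivAt_rot_comp {s : ℝ → ℝ} {y : ℝ → Fin 2 → ℝ} {s' : ℝ} {y' : Fin 2 → ℝ} {t : ℝ}
    (hs : HasDerivAt s s' t) (hy : HasDerivAt y y' t) :
    HasDerivAt (fun t => rot (s t) (y t))
      (s' • (exampleMatrix *ᵥ rot (s t) (y t)) + rot (s t) y') t := by
  have hA : HasDerivAt (fun t => exampleMatrix *ᵥ y t) (exampleMatrix *ᵥ y') t :=
    (LinearMap.toContinuousLinearMap (Matrix.mulVecLin exampleMatrix)).hasFDerivAt.comp_hasDerivAt
      t hy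
  convert! (hs.cos.smul hy).add (hs.sin.smul hA) using 1
  simp only [rot, Matrix.mulVec_add, Matrix.mulVec_smul, exampleMatrix_mulVec_mulVec]
  module

theorem contDiff_rot : ContDiff ℝ ∞ fun p : ℝ × (Fin 2 → ℝ) => rot p.1 p.2 := by
  have h := (contDiff_mulVec exampleMatrix).comp (contDiff_snd (E := ℝ))
  exact ((contDiff_cos.comp contDiff_fst).smul contDiff_snd).add
    ((contDiff_sin.comp contDiff_fst).smul h)

/-- The transport `x ↦ e^{-tA} f (e^{tA} x)` of a vector field by the linear flow. -/
noncomputable def transport (f : (Fin 2 → ℝ) → (Fin 2 → ℝ)) (t : ℝ) (x : Fin 2 → ℝ) : Fin 2 → ℝ :=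
  rot (-t) (f (rot t x))

theorem transport_transport (f : (Fin 2 → ℝ) → (Fin 2 → ℝ)) (s t : ℝ) (x : Fin 2 → ℝ) :
    transport (transport f t) s x = transport f (t + s) x := by
  simp only [transport, rot_rot, neg_add_rev]

@[simp]
theorem transport_zero (f : (Fin 2 → ℝ) → (Fin 2 → ℝ)) (x : Fin 2 → ℝ) :
    transport f 0 x = f x := by simp [transport]

theorem transport_periodic (f : (Fin 2 → ℝ) → (Fin 2 → ℝ)) (x : Fin 2 → ℝ) :
    Function.Periodic (fun t => transport f t x) (2 * π) := by
  intro t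
  simp only [transport, neg_add]
  rw [← rot_rot, ← rot_rot]
  simp

/-- `𝓛_A` is the infinitesimal generator of transport. Every statement about its kernel or image
below is read off by differentiating or integrating in `t`. -/
theorem hasDerivAt_transport {f : (Fin 2 → ℝ) → (Fin 2 → ℝ)} (hf : Differentiable ℝ f)
    (x : Fin 2 → ℝ) (t : ℝ) :
    HasDerivAt (fun t => transport f t x) (transport (homological exampleMatrix f) t x) t := by
  have h1 := hasDerivAt_rot_comp (hasDerivAt_id t) (hasDerivAt_const t x)
  have h2 := (hf (rot t x)).hasFDerivAt.comp_hasDerivAt t h1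
  convert! hasDerivAt_rot_comp (hasDerivAt_id t).neg h2 using 1
  have : rot t 0 = 0 := rot_apply_zero t
  simp only [transport, homological, rot_sub_vec, exampleMatrix_mulVec_rot, id, this, add_zero,
    one_smul, neg_smul, Pi.neg_apply]
  abel

theorem transport_eq_self {f : (Fin 2 → ℝ) → (Fin 2 → ℝ)} (hf : Differentiable ℝ f)
    (h : homological exampleMatrix f = 0) (t : ℝ) (x : Fin 2 → ℝ) : transport f t x = f x := by
  have hd : ∀ t, HasDerivAt (fun t => transport f t x) 0 t := fun t => by
    simpa [h, transport] using hasDerivAt_transport hf x t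
  have := is_const_of_deriv_eq_zero (fun t => (hd t).differentiableAt) (fun t => (hd t).deriv) t 0
  simpa using this

theorem apply_rot_of_homological_eq_zero {f : (Fin 2 → ℝ) → (Fin 2 → ℝ)}
    (hf : Differentiable ℝ f) (h : homological exampleMatrix f = 0) (t : ℝ) (x : Fin 2 → ℝ) :
    f (rot t x) = rot t (f x) := by
  rw [← transport_eq_self hf h t x, transport, rot_rot_neg]

theorem contDiff_transport {f : (Fin 2 → ℝ) → (Fin 2 → ℝ)} (hf : ContDiff ℝ ∞ f) :
    ContDiff ℝ ∞ fun p : ℝ × (Fin 2 → ℝ) => transport f p.1 p.2 := by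
  have h : ContDiff ℝ ∞ fun p : ℝ × (Fin 2 → ℝ) => (-p.1, f (rot p.1 p.2)) :=
    contDiff_fst.neg.prodMk (hf.comp contDiff_rot)
  have h2 := ContDiff.comp contDiff_rot h
  simpa only [Function.comp_def, transport] using h2

/-- The average of a vector field over the linear flow. -/
noncomputable def average (f : (Fin 2 → ℝ) → (Fin 2 → ℝ)) (x : Fin 2 → ℝ) : Fin 2 → ℝ :=
  (2 * π)⁻¹ • ∫ t in (0 : ℝ)..(2 * π), transport f t x

/-- A solution `h` of the homological equation `𝓛_A h = f - average f`. -/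
noncomputable def homologicalSolution (f : (Fin 2 → ℝ) → (Fin 2 → ℝ)) (x : Fin 2 → ℝ) : Fin 2 → ℝ :=
  (2 * π)⁻¹ • ∫ t in (0 : ℝ)..(2 * π), t • transport f t x

theorem average_mem {f : (Fin 2 → ℝ) → (Fin 2 → ℝ)} (hf : f ∈ smoothFields 2) :
    average f ∈ smoothFields 2 := by
  refine ⟨(contDiff_intervalIntegral (contDiff_transport hf.1) _ _).const_smul _, ?_⟩
  simp [average, transport, hf.2]

theorem homologicalSolution_mem {f : (Fin 2 → ℝ) → (Fin 2 → ℝ)} (hf : f ∈ smoothFields 2) :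
    homologicalSolution f ∈ smoothFields 2 := by
  refine ⟨(contDiff_intervalIntegral
    (f := fun p : ℝ × (Fin 2 → ℝ) => p.1 • transport f p.1 p.2)
    (contDiff_fst.smul (contDiff_transport hf.1)) _ _).const_smul _, ?_⟩
  simp [homologicalSolution, transport, hf.2]

variable {f : (Fin 2 → ℝ) → (Fin 2 → ℝ)}

theorem continuous_transport (hf : ContDiff ℝ ∞ f) (x : Fin 2 → ℝ) :
    Continuous fun t => transport f t x := by
  have h : Continuous fun t : ℝ => (t, x) := by fun_prop
  have h2 := (contDiff_transport hf).continuous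
  have h3 := h2.comp h
  simpa only [Function.comp_def] using h3

theorem rotCLM_intervalIntegral {g : ℝ → Fin 2 → ℝ} (hg : Continuous g) (s a b : ℝ) :
    rot s (∫ t in a..b, g t) = ∫ t in a..b, rot s (g t) :=
  ((rotCLM s).intervalIntegral_comp_comm (hg.intervalIntegrable a b)).symm

theorem transport_average (hf : ContDiff ℝ ∞ f) (s : ℝ) (x : Fin 2 → ℝ) :
    transport (average f) s x = average f x := by
  have h : ∀ t, rot (-s) (transport f t (rot s x)) = transport f (t + s) x := fun t =>
    transport_transport f s t x
  rw [transport, average, rot_smul, rotCLM_intervalIntegral (continuous_transport hf _)]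
  simp only [h]
  rw [intervalIntegral.integral_comp_add_right (fun t => transport f t x), zero_add,
    add_comm (2 * π) s, (transport_periodic f x).intervalIntegral_add_eq s 0, zero_add]
  rfl

theorem homological_average (hf : f ∈ smoothFields 2) :
    homological exampleMatrix (average f) = 0 := by
  funext x
  have h := hasDerivAt_transport ((average_mem hf).1.differentiable (by simp)) x 0
  simp only [transport_average hf.1, transport_zero] at h
  exact h.unique (hasDerivAt_const _ _)

/-- Shifting `t` by `s` turns the weight into `t - s` and moves the window to `[s, s + 2π]`. The
unweighted part returns to `[0, 2π]` by periodicity. All dependence on `s` is now explicit. -/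
theorem transport_homologicalSolution (hf : ContDiff ℝ ∞ f) (s : ℝ) (x : Fin 2 → ℝ) :
    transport (homologicalSolution f) s x =
      (2 * π)⁻¹ • ((∫ t in s..(s + 2 * π), t • transport f t x)
        - s • ∫ t in (0 : ℝ)..(2 * π), transport f t x) := by
  have hc := continuous_transport hf
  have h : ∀ t, rot (-s) (t • transport f t (rot s x)) = t • transport f (t + s) x := fun t => by
    rw [rot_smul]
    exact congrArg _ (transport_transport f s t x)
  rw [transport, homologicalSolution, rot_smul,
    rotCLM_intervalIntegral (g := fun t => t • transport f t (rot s x))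
      (continuous_id.smul (hc _))]
  simp only [h]
  congr 1
  have h2 := intervalIntegral.integral_comp_add_right (fun t => (t - s) • transport f t x) s
    (a := 0) (b := 2 * π)
  simp only [add_sub_cancel_right] at h2
  rw [h2, zero_add, add_comm (2 * π) s, ← zero_add (2 * π),
    ← (transport_periodic f x).intervalIntegral_add_eq s 0, zero_add]
  simp only [sub_smul]
  rw [intervalIntegral.integral_sub, intervalIntegral.integral_smul]
  · exact (continuous_id.smul (hc x)).intervalIntegrable _ _
  · exact ((hc x).const_smul s).intervalIntegrable _ _

/-- In the derivative at `s = 0`, the weights `2π` and `0` at the ends of the window contribute `2π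
f(x)`, and the linear term subtracts the full integral. -/
theorem homological_homologicalSolution (hf : f ∈ smoothFields 2) :
    homological exampleMatrix (homologicalSolution f) = f - average f := by
  funext x
  have h := hasDerivAt_transport ((homologicalSolution_mem hf).1.differentiable (by simp)) x 0
  simp only [transport_homologicalSolution hf.1] at h
  rw [transport_zero] at h
  have hc : Continuous fun t : ℝ => t • transport f t x :=
    continuous_id.smul (continuous_transport hf.1 x)
  have h1 : HasDerivAt (fun s => ∫ t in (0 : ℝ)..s, t • transport f t x)
      ((0 : ℝ) • transport f 0 x) 0 :=
    intervalIntegral.integral_hasDerivAt_right (hc.intervalIntegrable _ _)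
      (hc.stronglyMeasurableAtFilter _ _) hc.continuousAt
  have h2 : HasDerivAt (fun s => ∫ t in (0 : ℝ)..s, t • transport f t x)
      ((0 + 2 * π) • transport f (0 + 2 * π) x) (0 + 2 * π) :=
    intervalIntegral.integral_hasDerivAt_right (hc.intervalIntegrable _ _)
      (hc.stronglyMeasurableAtFilter _ _) hc.continuousAt
  have h3 := ((h2.comp_add_const 0 (2 * π)).sub h1).sub
    ((hasDerivAt_id (0 : ℝ)).smul_const (∫ t in (0 : ℝ)..(2 * π), transport f t x))
  have h4 := h3.const_smul (2 * π)⁻¹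
  have h5 := h.unique (h4.congr_of_eventuallyEq (Filter.Eventually.of_forall fun s => ?_))
  · have h6 : transport f (0 + 2 * π) x = transport f 0 x := transport_periodic f x 0
    rw [h5, h6]
    have : (2 * π)⁻¹ * (2 * π) = 1 := inv_mul_cancel₀ (by positivity)
    simp only [transport_zero, zero_smul, zero_add, one_smul, smul_sub, smul_smul, this,
      Pi.sub_apply, average, sub_zero]
  · simp only [id, Pi.smul_apply, Pi.sub_apply]
    rw [intervalIntegral.integral_interval_sub_left (hc.intervalIntegrable _ _)
      (hc.intervalIntegrable _ _)]

theorem average_homological (hf : f ∈ smoothFields 2) :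
    average (homological exampleMatrix f) = 0 := by
  funext x
  have h := intervalIntegral.integral_eq_sub_of_hasDerivAt (a := 0) (b := 2 * π)
    (fun t _ => hasDerivAt_transport (hf.1.differentiable (by simp)) x t)
    ((continuous_transport (homological_mem exampleMatrix hf).1 x).intervalIntegrable _ _)
  have h2 := transport_periodic f x 0
  simp only [zero_add] at h2
  rw [average, h, h2, sub_self, smul_zero, Pi.zero_apply]

theorem average_of_homological_eq_zero (hf : f ∈ smoothFields 2)
    (h : homological exampleMatrix f = 0) : average f = f := by
  funext x
  have : (2 * π)⁻¹ * (2 * π) = 1 := inv_mul_cancel₀ (by positivity)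
  simp [average, transport_eq_self (hf.1.differentiable (by simp)) h, smul_smul]
  field_simp
  simp

/-- `𝒳₀^∞(ℝ²) = Im 𝓛_A ⊕ Ker 𝓛_A`. -/
theorem isCompl_imageSpace_kernelSpace :
    IsCompl (imageSpace exampleMatrix) (kernelSpace exampleMatrix) := by
  constructor
  -- The average vanishes on the image and is the identity on the kernel, so a common element is
  -- zero.
  · rw [Submodule.disjoint_def]
    rintro _ ⟨g, rfl⟩ hk
    have hk' : homological exampleMatrix (homological exampleMatrix g) = 0 :=
      congrArg Subtype.val (LinearMap.mem_ker.1 hk)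
    ext1
    have h1 := average_of_homological_eq_zero (homological_mem exampleMatrix g.2) hk'
    rw [average_homological g.2] at h1
    exact h1.symm
  · rw [codisjoint_iff, eq_top_iff]
    intro f _
    refine Submodule.mem_sup.2 ⟨homologicalOp exampleMatrix ⟨_, homologicalSolution_mem f.2⟩,
      ⟨_, rfl⟩, ⟨average f, average_mem f.2⟩, ?_, ?_⟩
    · exact LinearMap.mem_ker.2 (Subtype.ext (homological_average f.2))
    · ext1
      simp [homologicalOp, homological_homologicalSolution f.2]

theorem projKernel_eq_average
    (hA : IsCompl (imageSpace exampleMatrix) (kernelSpace exampleMatrix)) (g : smoothFields 2) :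
    (projKernel exampleMatrix hA g : (Fin 2 → ℝ) → (Fin 2 → ℝ)) = average g := by
  have h1 : g = homologicalOp exampleMatrix ⟨_, homologicalSolution_mem g.2⟩
      + ⟨average g, average_mem g.2⟩ := by
    ext1
    simp [homologicalOp, homological_homologicalSolution g.2]
  have h2 : projKernel exampleMatrix hA (homologicalOp exampleMatrix
      ⟨_, homologicalSolution_mem g.2⟩) = 0 :=
    Submodule.projection_apply_of_mem_right hA.symm ⟨_, rfl⟩
  have h3 : projKernel exampleMatrix hA ⟨average g, average_mem g.2⟩ =
      ⟨average g, average_mem g.2⟩ :=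
    Submodule.projection_apply_of_mem_left hA.symm
      (LinearMap.mem_ker.2 (Subtype.ext (homological_average g.2)))
  conv_lhs => rw [h1]
  rw [map_add, h2, h3, zero_add]

end Averaging

/-! ### Integral representations, signs and zeros of `J₁` -/

section Bessel

open Real Set MeasureTheory

theorem integral_cos_pow_two_pi (k : ℕ) :
    ∫ u in (0 : ℝ)..(2 * π), cos u ^ (2 * k + 2) =
      2 * π * ((2 * k + 1).factorial / (k.factorial * (k + 1).factorial * 2 ^ (2 * k + 1))) := by
  induction k with
  | zero => rw [integral_cos_pow]; simp; ring
  | succ k ih =>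
    rw [show 2 * (k + 1) + 2 = 2 * k + 2 + 2 by ring, integral_cos_pow, ih]
    simp only [sin_two_pi, sin_zero, mul_zero, sub_self, zero_div, zero_add,
      show 2 * (k + 1) + 1 = 2 * k + 1 + 1 + 1 by ring, Nat.factorial_succ (2 * k + 1 + 1),
      Nat.factorial_succ (2 * k + 1), Nat.factorial_succ (k + 1), Nat.factorial_succ k]
    have := Nat.factorial_pos k
    push_cast
    field_simp
    ring

/-- The sine series is integrated term by term; the even moments of the cosine turn its coefficients
into those of `J₁`. -/
theorem besselJ_one_eq_integral (x : ℝ) :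
    besselJ 1 x = (2 * π)⁻¹ * ∫ u in (0 : ℝ)..(2 * π), sin (x * cos u) * cos u := by
  have hsum : HasSum (fun k : ℕ => ∫ u in (0 : ℝ)..(2 * π),
      (-1) ^ k * (x * cos u) ^ (2 * k + 1) / (2 * k + 1).factorial * cos u)
      (∫ u in (0 : ℝ)..(2 * π), sin (x * cos u) * cos u) := by
    refine intervalIntegral.hasSum_integral_of_dominated_convergence
      (fun k _ => |x| ^ (2 * k + 1) / (2 * k + 1).factorial) ?_ ?_ ?_ ?_ ?_
    · exact fun k => Continuous.aestronglyMeasurable (by fun_prop)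
    · refine fun k => ae_of_all _ fun u _ => ?_
      have hc := abs_cos_le_one u
      rw [norm_mul, norm_div, norm_mul, norm_pow, norm_pow, norm_mul]
      simp only [norm_eq_abs, abs_neg, abs_one, one_pow, one_mul, Nat.abs_cast]
      refine (mul_le_of_le_one_right (by positivity) hc).trans ?_
      gcongr
      exact mul_le_of_le_one_right (abs_nonneg x) hc
    · refine ae_of_all _ fun u _ => ?_
      exact (Real.summable_pow_div_factorial |x|).comp_injective
        (i := fun k : ℕ => 2 * k + 1) fun a b h => by simpa using h
    · simp
    · exact ae_of_all _ fun u _ => (Real.hasSum_sin (x * cos u)).mul_right (cos u)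
  rw [← (hsum.mul_left (2 * π)⁻¹).tsum_eq, besselJ]
  congr 1
  ext k
  have h : ∀ u, (-1) ^ k * (x * cos u) ^ (2 * k + 1) / (2 * k + 1).factorial * cos u =
      ((-1) ^ k * x ^ (2 * k + 1) / (2 * k + 1).factorial) * cos u ^ (2 * k + 2) := by
    intro u
    ring
  simp only [h]
  rw [intervalIntegral.integral_const_mul, integral_cos_pow_two_pi]
  have := Nat.factorial_pos k
  have := Nat.factorial_pos (k + 1)
  have := Nat.factorial_pos (2 * k + 1)
  rw [div_pow]
  field_simp

theorem continuous_besselJ_one : Continuous (besselJ 1) := by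
  rw [show besselJ 1 = _ from funext besselJ_one_eq_integral]
  refine continuous_const.mul ?_
  exact intervalIntegral.continuous_parametric_intervalIntegral_of_continuous'
    (f := fun x u => sin (x * cos u) * cos u) (by fun_prop) _ _

theorem besselJ_one_eq_integral_quarter (x : ℝ) :
    besselJ 1 x = 2 / π * ∫ u in (0 : ℝ)..(π / 2), sin (x * cos u) * cos u := by
  set f : ℝ → ℝ := fun u => sin (x * cos u) * cos u with hf
  have hc : Continuous f := by fun_prop
  have hp : Function.Periodic f π := fun u => by simp [hf]
  have h1 : ∫ u in (0 : ℝ)..(2 * π), f u = 2 * ∫ u in (0 : ℝ)..π, f u := by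
    rw [← intervalIntegral.integral_add_adjacent_intervals (b := π) (hc.intervalIntegrable _ _)
      (hc.intervalIntegrable _ _), two_mul π, hp.intervalIntegral_add_eq π 0, zero_add]
    ring
  have h2 : ∫ u in (0 : ℝ)..π, f u = 2 * ∫ u in (0 : ℝ)..(π / 2), f u := by
    have h := intervalIntegral.integral_comp_sub_left f π (a := 0) (b := π / 2)
    rw [show π - π / 2 = π / 2 by ring, sub_zero] at h
    have h' : ∀ u, f (π - u) = f u := fun u => by simp [hf, cos_pi_sub]
    simp only [h'] at h
    rw [← intervalIntegral.integral_add_adjacent_intervals (b := π / 2)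
      (hc.intervalIntegrable _ _) (hc.intervalIntegrable _ _), ← h]
    ring
  rw [besselJ_one_eq_integral, h1, h2]
  field_simp

/-- Integration by parts has no boundary term, and the substitution `s = x cos u` then exhibits the
height of the circle of radius `x` as the weight of the cosine. -/
theorem besselJ_one_eq_integral_sqrt {x : ℝ} (hx : 0 < x) (hs : sin x = 0) :
    besselJ 1 x = 2 / (π * x) * ∫ s in (0 : ℝ)..x, √(x ^ 2 - s ^ 2) * cos s := by
  have h1 : ∫ u in (0 : ℝ)..(π / 2), (sin (x * cos u) * cos u
      - sin u * cos (x * cos u) * (x * sin u)) = 0 := by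
    have h := intervalIntegral.integral_eq_sub_of_hasDerivAt (a := 0) (b := π / 2)
      (f := fun u => sin u * sin (x * cos u))
      (f' := fun u => sin (x * cos u) * cos u - sin u * cos (x * cos u) * (x * sin u))
      (fun u _ => ?_) (Continuous.intervalIntegrable (by fun_prop) _ _)
    · rw [h]; simp [hs]
    · convert! (hasDerivAt_sin u).mul (((hasDerivAt_cos u).const_mul x).sin) using 1
      ring
  rw [intervalIntegral.integral_sub (Continuous.intervalIntegrable (by fun_prop) _ _)
    (Continuous.intervalIntegrable (by fun_prop) _ _), sub_eq_zero] at h1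
  have h2 := intervalIntegral.integral_comp_mul_deriv (a := 0) (b := π / 2)
    (f := fun u => x * cos u) (f' := fun u => x * -sin u)
    (g := fun s => √(x ^ 2 - s ^ 2) * cos s)
    (fun u _ => (hasDerivAt_cos u).const_mul x) (by fun_prop) (by fun_prop)
  have h3 : ∀ u ∈ uIcc 0 (π / 2), ((fun s => √(x ^ 2 - s ^ 2) * cos s) ∘ fun u => x * cos u) u *
      (x * -sin u) = -x * (sin u * cos (x * cos u) * (x * sin u)) := by
    intro u hu
    rw [uIcc_of_le (by positivity)] at hu
    have hsin : 0 ≤ sin u := sin_nonneg_of_nonneg_of_le_pi hu.1 (by linarith [hu.2, pi_pos])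
    have : √(x ^ 2 - (x * cos u) ^ 2) = x * sin u := by
      rw [show x ^ 2 - (x * cos u) ^ 2 = (x * sin u) ^ 2 by
        rw [mul_pow, mul_pow, sin_sq]; ring]
      exact sqrt_sq (by positivity)
    simp only [Function.comp, this]
    ring
  rw [intervalIntegral.integral_congr h3, intervalIntegral.integral_const_mul, cos_pi_div_two,
    cos_zero, mul_zero, mul_one, intervalIntegral.integral_symm 0 x] at h2
  have h4 : ∫ s in (0 : ℝ)..x, √(x ^ 2 - s ^ 2) * cos s =
      x * ∫ u in (0 : ℝ)..(π / 2), sin u * cos (x * cos u) * (x * sin u) := by linarith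
  rw [besselJ_one_eq_integral_quarter, h1, h4, ← mul_assoc]
  congr 1
  field_simp

/-- The height `√(R² - s²)` of the circle satisfies `η' = -s / η`, which is the unperturbed case `e
= 0` of the sign lemma. -/
theorem besselJ_one_sign (n : ℕ) : 0 < (-1) ^ n * besselJ 1 ((n + 1) * π) := by
  have hR : 0 < (n + 1) * π := by positivity
  set R := (n + 1) * π with hR_def
  have hpos : ∀ x ∈ Ioo 0 R, 0 < R ^ 2 - x ^ 2 := fun x hx => by nlinarith [hx.1, hx.2]
  have h := integral_mul_cos_sign_of_hasDerivAt (η := fun s => √(R ^ 2 - s ^ 2)) (e := 0) n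
    (by norm_num) (by fun_prop) (fun x hx => sqrt_pos.2 (hpos x hx))
    (fun x hx => by simpa using hpos x hx) (fun x hx => by
      have h1 := ((hasDerivAt_pow 2 x).const_sub (R ^ 2)).sqrt (hpos x hx).ne'
      convert! h1 using 1
      have := (sqrt_pos.2 (hpos x hx)).ne'
      simp only [mul_zero, zero_mul, sub_zero]
      field_simp
      push_cast
      ring)
  rw [besselJ_one_eq_integral_sqrt hR (by
    rw [hR_def]; exact_mod_cast sin_nat_mul_pi (n + 1))]
  have := mul_pos (by positivity : 0 < 2 / (π * R)) h
  linarith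

/-- A continuous function with values of alternating sign at `(n + 1) π` and `(n + 2) π` has
a zero in between. -/
theorem exists_zero_of_alternating_sign {f : ℝ → ℝ} {a b : ℝ} (n : ℕ) (hab : a ≤ b)
    (hf : ContinuousOn f (Icc a b)) (ha : 0 < (-1) ^ n * f a) (hb : 0 < (-1) ^ (n + 1) * f b) :
    ∃ x ∈ Ioo a b, f x = 0 := by
  have h := intermediate_value_Ioo' hab (f := fun x => (-1) ^ n * f x)
    (continuousOn_const.mul hf)
  obtain ⟨x, hx, hx0⟩ := h (show (0 : ℝ) ∈ Ioo _ _ from ⟨by rw [pow_succ] at hb; linarith, ha⟩)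
  exact ⟨x, hx, by simpa using hx0⟩

theorem infinite_zeros_besselJ_one : {r : ℝ | 0 < r ∧ besselJ 1 (2 * r) = 0}.Infinite := by
  refine Set.infinite_of_forall_exists_gt fun y => ?_
  obtain ⟨n, hn⟩ := exists_nat_ge (2 * y)
  have h2 := besselJ_one_sign (n + 1)
  obtain ⟨x, hx, hx0⟩ := exists_zero_of_alternating_sign n (by push_cast; gcongr; simp)
    continuous_besselJ_one.continuousOn (besselJ_one_sign n) h2
  have hpi := pi_gt_three
  have hn0 : (0 : ℝ) ≤ n := n.cast_nonneg
  have : 2 * y < x := by nlinarith [hx.1]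
  have hx' : 0 < x := lt_trans (by positivity) hx.1
  exact ⟨x / 2, ⟨by positivity, by rw [mul_div_cancel₀ x two_ne_zero]; exact hx0⟩, by linarith⟩

end Bessel

/-! ### The first-order normal form in polar coordinates -/

section PolarNormalForm

open Real Set MeasureTheory

theorem exampleMatrix_mulVec (x : Fin 2 → ℝ) : exampleMatrix *ᵥ x = ![x 1, -x 0] := by
  ext i
  fin_cases i <;> simp [exampleMatrix, dotProduct, Fin.sum_univ_two]

theorem rot_eq (t : ℝ) (x : Fin 2 → ℝ) :
    rot t x = ![cos t * x 0 + sin t * x 1, cos t * x 1 - sin t * x 0] := by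
  rw [rot, exampleMatrix_mulVec]
  ext i
  fin_cases i <;> simp
  ring

theorem polarPoint_eq_rot (r θ : ℝ) : polarPoint r θ = rot θ ![2 * r, 0] := by
  ext i
  fin_cases i <;>
    simp [polarPoint, rot_eq] <;> ring

theorem polarPoint_periodic (r : ℝ) : Function.Periodic (polarPoint r) (2 * π) := fun θ => by
  simp [polarPoint]

theorem polarPoint_sq (r θ : ℝ) : polarPoint r θ 0 ^ 2 + polarPoint r θ 1 ^ 2 = (2 * r) ^ 2 := by
  simp only [polarPoint, Matrix.cons_val_zero, Matrix.cons_val_one]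
  linear_combination (2 * r) ^ 2 * sin_sq_add_cos_sq θ

theorem hasDerivAt_polarPoint {r θ : ℝ → ℝ} {r' θ' t : ℝ} (hr : HasDerivAt r r' t)
    (hθ : HasDerivAt θ θ' t) :
    HasDerivAt (fun s => polarPoint (r s) (θ s))
      (θ' • (exampleMatrix *ᵥ polarPoint (r t) (θ t)) + polarPoint r' (θ t)) t := by
  simp only [polarPoint_eq_rot]
  refine hasDerivAt_rot_comp hθ (hasDerivAt_pi.2 fun i => ?_)
  fin_cases i
  · exact hr.const_mul 2
  · exact hasDerivAt_const t 0

theorem average_rot {f : (Fin 2 → ℝ) → (Fin 2 → ℝ)} (hf : f ∈ smoothFields 2) (t : ℝ)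
    (x : Fin 2 → ℝ) : average f (rot t x) = rot t (average f x) :=
  apply_rot_of_homological_eq_zero ((average_mem hf).1.differentiable (by simp))
    (homological_average hf) t x

/-- By equivariance only points of the first axis matter. There the first component is the Bessel
integral, and the second vanishes because its integrand is odd under `t ↦ 2π - t`. -/
theorem average_examplePerturbation (r θ : ℝ) :
    average examplePerturbation (polarPoint r θ) = polarPoint (besselJ 1 (2 * r)) θ := by
  rw [polarPoint_eq_rot, average_rot examplePerturbation.2, polarPoint_eq_rot]
  congr 1
  have hc := continuous_transport examplePerturbation.2.1 ![2 * r, 0]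
  have ht : ∀ t, transport examplePerturbation t ![2 * r, 0] =
      ![2 * (sin (2 * r * cos t) * cos t), 2 * (sin (2 * r * cos t) * sin t)] := by
    intro t
    ext i
    fin_cases i <;>
      simp [transport, examplePerturbation, rot_eq, mul_comm (cos t), mul_assoc]
    ring
  have hi : ∀ i : Fin 2, average examplePerturbation ![2 * r, 0] i = (2 * π)⁻¹ *
      ∫ t in (0 : ℝ)..(2 * π), transport examplePerturbation t ![2 * r, 0] i := by
    intro i
    rw [average, Pi.smul_apply, smul_eq_mul]
    congr 1
    exact ((ContinuousLinearMap.proj (R := ℝ) (φ := fun _ : Fin 2 => ℝ)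
      i).intervalIntegral_comp_comm (hc.intervalIntegrable 0 (2 * π))).symm
  ext i
  rw [hi]
  simp only [ht]
  fin_cases i
  · simp only [Fin.zero_eta, Matrix.cons_val_zero]
    rw [intervalIntegral.integral_const_mul, besselJ_one_eq_integral]
    ring
  · have h := intervalIntegral.integral_comp_sub_left (fun t => sin (2 * r * cos t) * sin t)
      (2 * π) (a := 0) (b := 2 * π)
    have h' : ∀ t, sin (2 * r * cos (2 * π - t)) * sin (2 * π - t) =
        -(sin (2 * r * cos t) * sin t) := fun t => by
      rw [cos_two_pi_sub, sin_two_pi_sub]; ring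
    simp only [h', sub_self, sub_zero, intervalIntegral.integral_neg] at h
    have h0 : ∫ t in (0 : ℝ)..(2 * π), sin (2 * r * cos t) * sin t = 0 := by linarith
    simp [intervalIntegral.integral_const_mul, h0]

theorem firstOrderNormalForm_polarPoint
    (hA : IsCompl (imageSpace exampleMatrix) (kernelSpace exampleMatrix)) (ε r θ : ℝ) :
    firstOrderNormalForm exampleMatrix hA examplePerturbation ε (polarPoint r θ) =
      exampleMatrix *ᵥ polarPoint r θ + polarPoint (ε * besselJ 1 (2 * r)) θ := by
  rw [firstOrderNormalForm, projKernel_eq_average, average_examplePerturbation]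
  congr 1
  ext i
  fin_cases i <;> simp [polarPoint] <;> ring

theorem hasDerivAt_polarPoint_iff
    (hA : IsCompl (imageSpace exampleMatrix) (kernelSpace exampleMatrix)) (ε : ℝ) (r θ : ℝ → ℝ)
    (t : ℝ) (hr : DifferentiableAt ℝ r t) (hθ : DifferentiableAt ℝ θ t) (h0 : 0 < r t) :
    HasDerivAt (fun s => polarPoint (r s) (θ s))
        (firstOrderNormalForm exampleMatrix hA examplePerturbation ε (polarPoint (r t) (θ t))) t ↔
      HasDerivAt r (ε * besselJ 1 (2 * r t)) t ∧ HasDerivAt θ 1 t := by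
  rw [firstOrderNormalForm_polarPoint]
  constructor
  · intro h
    have h1 := (hasDerivAt_polarPoint hr.hasDerivAt hθ.hasDerivAt).unique h
    -- Rotating back to the first axis separates the radial and angular components.
    have h2 := congrArg (rot (-θ t)) h1
    simp only [polarPoint_eq_rot, rot_add_vec, rot_smul, exampleMatrix_mulVec_rot,
      rot_neg_rot] at h2
    have e0 := congrFun h2 0
    have e1 := congrFun h2 1
    simp only [exampleMatrix_mulVec, Pi.add_apply, Pi.smul_apply, Matrix.cons_val_zero,
      Matrix.cons_val_one, smul_eq_mul] at e0 e1
    have e0' : deriv r t = ε * besselJ 1 (2 * r t) := by linarith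
    have e1' : deriv θ t = 1 := mul_right_cancel₀ (b := r t) h0.ne' (by linarith)
    rw [← e0', ← e1']
    exact ⟨hr.hasDerivAt, hθ.hasDerivAt⟩
  · rintro ⟨h1, h2⟩
    simpa using hasDerivAt_polarPoint h1 h2

theorem infinite_periodicOrbits_firstOrderNormalForm
    (hA : IsCompl (imageSpace exampleMatrix) (kernelSpace exampleMatrix)) (ε : ℝ) :
    (periodicOrbits (firstOrderNormalForm exampleMatrix hA examplePerturbation ε)).Infinite := by
  refine Set.infinite_of_injOn_mapsTo (f := fun r => range (polarPoint r)) ?_ ?_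
    infinite_zeros_besselJ_one
  · intro r hr s hs h
    have h1 : polarPoint r 0 ∈ range (polarPoint s) := by
      rw [← show range (polarPoint r) = range (polarPoint s) from h]
      exact mem_range_self 0
    obtain ⟨θ, hθ⟩ := h1
    have h2 := polarPoint_sq s θ
    rw [hθ, polarPoint_sq] at h2
    have h3 := (sq_eq_sq₀ (by linarith [hr.1]) (by linarith [hs.1])).1 h2
    linarith
  · rintro r ⟨hr, hr0⟩
    refine ⟨polarPoint r, 2 * π, by positivity, fun t => ?_, polarPoint_periodic r, ⟨π, ?_⟩, rfl⟩
    · refine (hasDerivAt_polarPoint_iff hA ε (fun _ => r) id t (differentiableAt_const _)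
        differentiableAt_id hr).2 ⟨?_, hasDerivAt_id t⟩
      rw [hr0, mul_zero]
      exact hasDerivAt_const t r
    · intro h
      have := congrFun h 0
      simp [polarPoint] at this
      linarith

end PolarNormalForm

/-! ### Polar equation and energy change over a quarter turn -/

section QuarterTurn

open Real Set

/-- The angular speed of the example in polar coordinates `x₁ = ρ cos θ`, `x₂ = - ρ sin θ`. -/
noncomputable def angularSpeed (e θ ρ : ℝ) : ℝ := 1 - 2 * e * sin θ * sin (ρ * cos θ) / ρ

/-- The slope `dρ/dθ` of the orbits of the example in polar coordinates. -/
noncomputable def polarSlope (e θ ρ : ℝ) : ℝ := 2 * e * cos θ * sin (ρ * cos θ) / angularSpeed e θ ρ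

/-- This keeps the angular speed in `[4/5, 6/5]`, so that the angle can replace time outside the
unit disc. -/
theorem abs_angularSpeed_sub_one_le {e θ ρ : ℝ} (he : |e| ≤ 1 / 10) (hρ : 1 ≤ ρ) :
    |angularSpeed e θ ρ - 1| ≤ 1 / 5 := by
  have h0 : 0 < ρ := by linarith
  have h1 : |2 * e * sin θ * sin (ρ * cos θ)| ≤ 1 / 5 := by
    rw [abs_mul, abs_mul, abs_mul, abs_two]
    have h2 : 2 * |e| ≤ 1 / 5 := by linarith
    have h3 : 2 * |e| * |sin θ| ≤ 1 / 5 :=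
      (mul_le_of_le_one_right (by positivity) (abs_sin_le_one _)).trans h2
    exact (mul_le_of_le_one_right (by positivity) (abs_sin_le_one _)).trans h3
  rw [angularSpeed, sub_sub_cancel_left, abs_neg, abs_div, abs_of_pos h0, div_le_iff₀ h0]
  linarith

theorem angularSpeed_pos {e θ ρ : ℝ} (he : |e| ≤ 1 / 10) (hρ : 1 ≤ ρ) :
    4 / 5 ≤ angularSpeed e θ ρ := by
  have := (abs_le.1 (abs_angularSpeed_sub_one_le (θ := θ) he hρ)).1
  linarith

theorem exists_continuous_inverse {f : ℝ → ℝ} {a b : ℝ} (hab : a ≤ b)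
    (hf : ContinuousOn f (Icc a b)) (hanti : StrictAntiOn f (Icc a b)) :
    ∃ τ : ℝ → ℝ, Continuous τ ∧ (∀ x, τ x ∈ Icc a b) ∧ (∀ t ∈ Icc a b, τ (f t) = t) ∧
      ∀ x ∈ Icc (f b) (f a), f (τ x) = x := by
  set p : ℝ → ℝ := fun t => projIcc a b hab t with hp
  have hpc : Continuous p := continuous_subtype_val.comp continuous_projIcc
  have hpm : ∀ t, p t ∈ Icc a b := fun t => (projIcc a b hab t).2
  have hpi : ∀ t ∈ Icc a b, p t = t := fun t ht => by
    rw [hp]; simp only [projIcc_of_mem hab ht]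
  have hfp : Continuous fun t => f (p t) := hf.comp_continuous hpc hpm
  have hpmono : Monotone p := fun s t h => monotone_projIcc hab h
  have hpsub : ∀ s t, s ≤ t → p t - p s ≤ t - s := by
    intro s t h
    have := abs_projIcc_sub_projIcc (h := hab) (c := t) (d := s)
    rw [abs_of_nonneg (sub_nonneg.2 h)] at this
    exact (le_abs_self _).trans this
  -- `-f` continued with slope one beyond both endpoints: a strictly increasing bijection of the
  -- line, whose inverse is continuous.
  set g : ℝ → ℝ := fun t => (t - p t) - f (p t) with hg
  have hgc : Continuous g := (continuous_id.sub hpc).sub hfp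
  have hgmono : StrictMono g := by
    intro s t h
    have h1 := hpsub s t h.le
    rcases (hpmono h.le).lt_or_eq with h2 | h2
    · have := hanti (hpm s) (hpm t) h2
      simp only [hg]; linarith
    · simp only [hg, h2]; linarith
  have hfb : ∀ t, f b ≤ f (p t) ∧ f (p t) ≤ f a := fun t =>
    ⟨hanti.antitoneOn (hpm t) (right_mem_Icc.2 hab) (hpm t).2,
      hanti.antitoneOn (left_mem_Icc.2 hab) (hpm t) (hpm t).1⟩
  have hgsurj : Function.Surjective g := by
    refine hgc.surjective ?_ ?_
    · refine Filter.tendsto_atTop_mono (f := fun t => t + (-b - f a)) (fun t => ?_)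
        (Filter.tendsto_atTop_add_const_right _ _ Filter.tendsto_id)
      have := (hpm t).2
      simp only [hg]; linarith [(hfb t).2]
    · refine Filter.tendsto_atBot_mono (f := fun t => t + (-a - f b)) (fun t => ?_)
        (Filter.tendsto_atBot_add_const_right _ _ Filter.tendsto_id)
      have := (hpm t).1
      simp only [hg]; linarith [(hfb t).1]
  set G := hgmono.orderIsoOfSurjective g hgsurj
  have hGinv : ∀ t ∈ Icc a b, G.symm (-f t) = t := by
    intro t ht
    have : G t = -f t := by
      change g t = _
      simp [hg, hpi t ht]
    rw [← this, OrderIso.symm_apply_apply]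
  refine ⟨fun x => p (G.symm (-x)), hpc.comp (G.symm.continuous.comp continuous_neg),
    fun x => hpm _, fun t ht => ?_, fun x hx => ?_⟩
  · simp only [hGinv t ht, hpi t ht]
  · obtain ⟨t, ht, rfl⟩ := intermediate_value_Icc' hab hf hx
    simp only [hGinv t ht, hpi t ht]

variable {e : ℝ} {ρ : ℝ → ℝ} {s : Set ℝ} {θ : ℝ}

/-- This is `dx₁/dθ = ẋ₁/θ̇` with `x₂ = -ρ sin θ`; the next lemma is the same for `-x₂`. -/
theorem hasDerivWithinAt_mul_cos (hD : angularSpeed e θ (ρ θ) ≠ 0) (h0 : ρ θ ≠ 0)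
    (h : HasDerivWithinAt ρ (polarSlope e θ (ρ θ)) s θ) :
    HasDerivWithinAt (fun θ => ρ θ * cos θ)
      (-(ρ θ * sin θ - 2 * e * sin (ρ θ * cos θ)) / angularSpeed e θ (ρ θ)) s θ := by
  refine (h.mul (hasDerivAt_cos θ).hasDerivWithinAt).congr_deriv ?_
  rw [polarSlope, eq_div_iff hD, add_mul, div_mul_eq_mul_div, div_mul_cancel₀ _ hD, angularSpeed]
  field_simp
  rw [mul_comm (cos θ) (ρ θ)]
  linear_combination (2 * e * sin (ρ θ * cos θ)) * sin_sq_add_cos_sq θ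

theorem hasDerivWithinAt_mul_sin (hD : angularSpeed e θ (ρ θ) ≠ 0) (h0 : ρ θ ≠ 0)
    (h : HasDerivWithinAt ρ (polarSlope e θ (ρ θ)) s θ) :
    HasDerivWithinAt (fun θ => ρ θ * sin θ) (ρ θ * cos θ / angularSpeed e θ (ρ θ)) s θ := by
  refine (h.mul (hasDerivAt_sin θ).hasDerivWithinAt).congr_deriv ?_
  rw [polarSlope, eq_div_iff hD, add_mul, div_mul_eq_mul_div, div_mul_cancel₀ _ hD, angularSpeed]
  field_simp
  ring

/-- The change of the energy along a quarter turn which starts at `((n + 1) π, 0)`. -/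
theorem exists_energy_change_quarter_turn (n : ℕ) (he : |e| ≤ 1 / 10)
    (h0 : ρ 0 = (n + 1) * π) (h1 : ∀ θ ∈ Icc 0 (π / 2), 1 ≤ ρ θ)
    (hρ : ∀ θ ∈ Icc 0 (π / 2),
      HasDerivWithinAt ρ (polarSlope e θ (ρ θ)) (Icc 0 (π / 2)) θ) :
    ∃ I, 0 < (-1) ^ n * I ∧ ρ (π / 2) ^ 2 = ρ 0 ^ 2 + 4 * e * I := by
  have hpi := pi_pos
  have hpi2 : 0 ≤ π / 2 := by positivity
  set R := (n + 1) * π with hR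
  have hsinR : sin R = 0 := by rw [hR]; exact_mod_cast sin_nat_mul_pi (n + 1)
  have hD : ∀ θ ∈ Icc 0 (π / 2), 0 < angularSpeed e θ (ρ θ) := fun θ hθ =>
    lt_of_lt_of_le (by norm_num) (angularSpeed_pos he (h1 θ hθ))
  have hρ0 : ∀ θ ∈ Icc 0 (π / 2), 0 < ρ θ := fun θ hθ => by linarith [h1 θ hθ]
  set X : ℝ → ℝ := fun θ => ρ θ * cos θ with hX
  set V : ℝ → ℝ := fun θ => ρ θ * sin θ with hV
  -- `u = -ẋ₁`. Its positivity makes `x₁` decrease, so that `x₁` can serve as the parameter. It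
  -- starts at `0` because `sin R = 0`.
  set u : ℝ → ℝ := fun θ => V θ - 2 * e * sin (X θ) with hu
  have hXd : ∀ θ ∈ Icc 0 (π / 2), HasDerivWithinAt X (-u θ / angularSpeed e θ (ρ θ))
      (Icc 0 (π / 2)) θ := fun θ hθ =>
    hasDerivWithinAt_mul_cos (hD θ hθ).ne' (hρ0 θ hθ).ne' (hρ θ hθ)
  have hVd : ∀ θ ∈ Icc 0 (π / 2), HasDerivWithinAt V (X θ / angularSpeed e θ (ρ θ))
      (Icc 0 (π / 2)) θ := fun θ hθ =>
    hasDerivWithinAt_mul_sin (hD θ hθ).ne' (hρ0 θ hθ).ne' (hρ θ hθ)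
  have hud : ∀ θ ∈ Icc 0 (π / 2), HasDerivWithinAt u (X θ / angularSpeed e θ (ρ θ)
      - 2 * e * (cos (X θ) * (-u θ / angularSpeed e θ (ρ θ)))) (Icc 0 (π / 2)) θ := fun θ hθ =>
    (hVd θ hθ).sub ((hXd θ hθ).sin.const_mul (2 * e))
  have hXpos : ∀ θ ∈ Ico 0 (π / 2), 0 < X θ := fun θ hθ =>
    mul_pos (hρ0 θ (Ico_subset_Icc_self hθ)) (cos_pos_of_mem_Ioo ⟨by linarith [hθ.1], hθ.2⟩)
  have hX0 : X 0 = R := by simp [hX, h0]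
  have hX1 : X (π / 2) = 0 := by simp [hX]
  have hu0 : u 0 = 0 := by simp [hu, hV, hX0, hsinR]
  -- Wherever `u` vanishes before `π / 2`, its derivative is `X / angularSpeed > 0`, so it cannot
  -- cross to negative values. The same derivative then excludes an interior zero, which would be a
  -- local minimum.
  have hnonneg : ∀ θ ∈ Icc 0 (π / 2), 0 ≤ u θ := by
    intro θ hθ
    have := image_le_of_deriv_right_lt_deriv_boundary (f := fun θ => -u θ) (B := fun _ => 0)
      (B' := fun _ => 0) (fun θ hθ => (hud θ hθ).continuousWithinAt.neg)
      (fun θ hθ => ((hud θ (Ico_subset_Icc_self hθ)).neg.mono_of_mem_nhdsWithin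
        (Icc_mem_nhdsGE_of_mem hθ))) (by simp [hu0]) (fun x => hasDerivAt_const x _)
      (fun θ hθ h => ?_) hθ
    · linarith
    · have h2 : u θ = 0 := by linarith
      have := div_pos (hXpos θ hθ) (hD θ (Ico_subset_Icc_self hθ))
      simp only [h2]
      simpa using this
  have hupos : ∀ θ ∈ Ioo 0 (π / 2), 0 < u θ := by
    intro θ hθ
    refine (hnonneg θ (Ioo_subset_Icc_self hθ)).lt_of_ne fun h => ?_
    have hmem := Icc_mem_nhds hθ.1 hθ.2
    have hmin : IsLocalMin u θ := by
      filter_upwards [hmem] with t ht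
      rw [← h]
      exact hnonneg t ht
    have h2 := hmin.hasDerivAt_eq_zero ((hud θ (Ioo_subset_Icc_self hθ)).hasDerivAt hmem)
    rw [← h] at h2
    have := div_pos (hXpos θ (Ioo_subset_Ico_self hθ)) (hD θ (Ioo_subset_Icc_self hθ))
    simp at h2
    rcases h2 with h2 | h2
    · linarith [hXpos θ (Ioo_subset_Ico_self hθ)]
    · linarith [hD θ (Ioo_subset_Icc_self hθ)]
  have hXanti : StrictAntiOn X (Icc 0 (π / 2)) := by
    refine strictAntiOn_of_deriv_neg (convex_Icc _ _) (fun θ hθ => (hXd θ hθ).continuousWithinAt)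
      fun θ hθ => ?_
    rw [interior_Icc] at hθ
    rw [((hXd θ (Ioo_subset_Icc_self hθ)).hasDerivAt (Icc_mem_nhds hθ.1 hθ.2)).deriv, neg_div,
      neg_lt_zero]
    exact div_pos (hupos θ hθ) (hD θ (Ioo_subset_Icc_self hθ))
  obtain ⟨τ, hτc, hτm, hτX, hXτ⟩ := exists_continuous_inverse hpi2
    (fun θ hθ => (hXd θ hθ).continuousWithinAt) hXanti
  rw [hX0, hX1] at hXτ
  have hτ0 : τ R = 0 := by rw [← hX0]; exact hτX 0 ⟨le_rfl, hpi2⟩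
  have hτ1 : τ 0 = π / 2 := by
    conv_lhs => rw [← hX1]
    exact hτX _ ⟨hpi2, le_rfl⟩
  have hτIoo : ∀ x ∈ Ioo 0 R, τ x ∈ Ioo 0 (π / 2) := by
    intro x hx
    have hx' := hXτ x (Ioo_subset_Icc_self hx)
    refine ⟨(hτm x).1.lt_of_ne fun h => ?_, (hτm x).2.lt_of_ne fun h => ?_⟩
    · rw [← h, hX0] at hx'; exact hx.2.ne' hx'
    · rw [h, hX1] at hx'; exact hx.1.ne hx'
  -- The trajectory as a graph over the `x₁`-axis, with the differential equation required by the
  -- sign lemma.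
  set η : ℝ → ℝ := fun x => V (τ x) with hη
  have hηc : Continuous η :=
    ContinuousOn.comp_continuous (fun θ hθ => (hVd θ hθ).continuousWithinAt) hτc hτm
  have hden : ∀ x ∈ Ioo 0 R, η x - 2 * e * sin x = u (τ x) := fun x hx => by
    simp only [hu, hη, hXτ x (Ioo_subset_Icc_self hx)]
  have hηd : ∀ x ∈ Ioo 0 R, HasDerivAt η (-(x / (η x - 2 * e * sin x))) x := by
    intro x hx
    have hθ := hτIoo x hx
    have hmem := Icc_mem_nhds hθ.1 hθ.2
    have hu' := hupos _ hθ
    have hD' := hD _ (hτm x)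
    have h2 : HasDerivAt τ (-u (τ x) / angularSpeed e (τ x) (ρ (τ x)))⁻¹ x := by
      refine HasDerivAt.of_local_left_inverse hτc.continuousAt
        ((hXd _ (hτm x)).hasDerivAt hmem) ?_ ?_
      · exact div_ne_zero (neg_ne_zero.2 hu'.ne') hD'.ne'
      · filter_upwards [Icc_mem_nhds hx.1 hx.2] with y hy using hXτ y hy
    have h3 := ((hVd _ (hτm x)).hasDerivAt hmem).comp x h2
    refine h3.congr_deriv ?_
    rw [hden x hx, hXτ x (Ioo_subset_Icc_self hx)]
    field_simp
  refine ⟨∫ x in (0 : ℝ)..R, η x * cos x, integral_mul_cos_sign_of_hasDerivAt n he hηc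
    (fun x hx => ?_) (fun x hx => ?_) hηd, ?_⟩
  · have hθ := hτIoo x hx
    exact mul_pos (hρ0 _ (hτm x)) (sin_pos_of_pos_of_lt_pi hθ.1 (by linarith [hθ.2]))
  · rw [hden x hx]
    exact hupos _ (hτIoo x hx)
  · have hR0 : 0 ≤ R := by positivity
    -- The correction `-2 e η sin x` vanishes at both ends and reduces the derivative of the energy
    -- to `-2 e η cos x` by the equation for `η`.
    have h2 := intervalIntegral.integral_eq_sub_of_hasDerivAt_of_le hR0
      (f := fun x => (η x ^ 2 + x ^ 2) / 2 - 2 * e * sin x * η x)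
      (f' := fun x => -(2 * e) * (η x * cos x)) (by fun_prop) (fun x hx => ?_)
      (Continuous.intervalIntegrable (by fun_prop) _ _)
    · rw [intervalIntegral.integral_const_mul] at h2
      have hη0 : η 0 = ρ (π / 2) := by simp [hη, hτ1, hV]
      have hηR : η R = 0 := by simp [hη, hτ0, hV]
      rw [hη0, hηR, sin_zero] at h2
      rw [h0]
      linarith
    · have hu' : η x - 2 * e * sin x ≠ 0 := by
        rw [hden x hx]
        exact (hupos _ (hτIoo x hx)).ne'
      have h3 := ((((hηd x hx).pow 2).add (hasDerivAt_pow 2 x)).div_const 2).sub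
        (((hasDerivAt_sin x).const_mul (2 * e)).mul (hηd x hx))
      refine h3.congr_deriv ?_
      field_simp
      push_cast
      ring

end QuarterTurn

/-! ### Half turns, closing up, and infinitely many periodic orbits -/

section LimitCycles

open Real Set

theorem abs_polarSlope_le {e θ p : ℝ} (he : |e| ≤ 1 / 10) (hp : 1 ≤ p) :
    |polarSlope e θ p| ≤ 1 / 4 := by
  have hD := angularSpeed_pos (θ := θ) he hp
  rw [polarSlope, abs_div, abs_of_pos (a := angularSpeed e θ p) (by linarith),
    div_le_iff₀ (by linarith)]
  have h1 : |2 * e * cos θ * sin (p * cos θ)| ≤ 1 / 5 := by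
    rw [abs_mul, abs_mul, abs_mul, abs_two]
    have h2 : 2 * |e| ≤ 1 / 5 := by linarith
    have h3 : 2 * |e| * |cos θ| ≤ 1 / 5 :=
      (mul_le_of_le_one_right (by positivity) (abs_cos_le_one _)).trans h2
    exact (mul_le_of_le_one_right (by positivity) (abs_sin_le_one _)).trans h3
  linarith

/-- A Lipschitz constant independent of the angle and the radius, as Picard–Lindelöf requires: the
numerator contributes at most `2/5 |p - q|`, the product of angular speeds is at least `1/2`. -/
theorem abs_polarSlope_sub_le {e θ p q : ℝ} (he : |e| ≤ 1 / 10) (hp : 1 ≤ p) (hq : 1 ≤ q) :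
    |polarSlope e θ p - polarSlope e θ q| ≤ |p - q| := by
  have hDp := angularSpeed_pos (θ := θ) he hp
  have hDq := angularSpeed_pos (θ := θ) he hq
  have hp0 : 0 < p := by linarith
  have hq0 : 0 < q := by linarith
  set c := cos θ
  set S := sin (p * c) - sin (q * c) with hS
  have hS1 : |S| ≤ |p - q| := by
    refine (abs_sin_sub_sin_le _ _).trans ?_
    rw [← sub_mul, abs_mul]
    exact mul_le_of_le_one_right (abs_nonneg _) (abs_cos_le_one θ)
  have hprod : polarSlope e θ p - polarSlope e θ q = 2 * e * c *
      (S - 2 * e * sin θ * (sin (p * c) * sin (q * c)) * ((p - q) / (p * q))) /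
      (angularSpeed e θ p * angularSpeed e θ q) := by
    rw [polarSlope, polarSlope, div_sub_div _ _ (by linarith) (by linarith)]
    congr 1
    simp only [angularSpeed, hS, c]
    field_simp
    ring
  have h1 : |2 * e * c| ≤ 1 / 5 := by
    rw [abs_mul, abs_mul, abs_two]
    exact (mul_le_of_le_one_right (by positivity) (abs_cos_le_one _)).trans (by linarith)
  have h2 : |2 * e * sin θ * (sin (p * c) * sin (q * c)) * ((p - q) / (p * q))| ≤ |p - q| := by
    rw [abs_mul]
    have h3 : |2 * e * sin θ * (sin (p * c) * sin (q * c))| ≤ 1 := by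
      rw [abs_mul, abs_mul, abs_mul, abs_mul, abs_two]
      have h4 : 2 * |e| ≤ 1 := by linarith
      have h5 : 2 * |e| * |sin θ| ≤ 1 :=
        (mul_le_of_le_one_right (by positivity) (abs_sin_le_one _)).trans h4
      exact (mul_le_of_le_one_right (by positivity) (mul_le_one₀ (abs_sin_le_one _)
        (abs_nonneg _) (abs_sin_le_one _))).trans h5
    have h6 : |(p - q) / (p * q)| ≤ |p - q| := by
      rw [abs_div, abs_of_pos (by positivity : 0 < p * q)]
      exact div_le_self (abs_nonneg _) (by nlinarith)
    exact (mul_le_of_le_one_left (abs_nonneg _) h3).trans h6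
  have h7 : |S - 2 * e * sin θ * (sin (p * c) * sin (q * c)) * ((p - q) / (p * q))| ≤
      2 * |p - q| := (abs_sub _ _).trans (by linarith)
  have hDD : 1 / 2 ≤ angularSpeed e θ p * angularSpeed e θ q := by nlinarith
  rw [hprod, abs_div, abs_mul, abs_of_pos (by linarith :
    0 < angularSpeed e θ p * angularSpeed e θ q), div_le_iff₀ (by linarith)]
  have h8 := mul_le_mul h1 h7 (abs_nonneg _) (by norm_num)
  nlinarith [abs_nonneg (p - q)]

theorem continuous_angularSpeed_comp {e : ℝ} {ρ : ℝ → ℝ} (hρ : Continuous ρ) (h0 : ∀ θ, ρ θ ≠ 0) :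
    Continuous fun θ => angularSpeed e θ (ρ θ) := by
  unfold angularSpeed
  exact continuous_const.sub (Continuous.div (by fun_prop) hρ h0)

/-- The flow of the polar equation over half a turn. -/
theorem exists_polar_flow {e : ℝ} (he : |e| ≤ 1 / 10) (a b : ℝ) (ha : 2 ≤ a) (hab : a ≤ b) :
    ∃ α : ℝ → ℝ → ℝ,
      (∀ s ∈ Icc a b, α s 0 = s ∧ (∀ θ ∈ Icc (-(π / 2)) (π / 2), 1 ≤ α s θ) ∧
        ∀ θ ∈ Icc (-(π / 2)) (π / 2),
          HasDerivWithinAt (α s) (polarSlope e θ (α s θ)) (Icc (-(π / 2)) (π / 2)) θ) ∧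
      ∀ θ ∈ Icc (-(π / 2)) (π / 2), ContinuousOn (fun s => α s θ) (Icc a b) := by
  have hpi := pi_pos
  have hpi4 := pi_lt_four
  have h0 : (0 : ℝ) ∈ Icc (-(π / 2)) (π / 2) := ⟨by linarith, by linarith⟩
  set r : NNReal := ⟨(b - a) / 2, by linarith⟩
  -- Truncation at radius `1` makes the bounds global. With slope at most `1/4` and angle at most
  -- `π/2 < 2`, radii starting above `2` never reach the truncation, and a margin of `1` around the
  -- initial interval suffices.
  have hPL : IsPicardLindelof (fun θ p => polarSlope e θ (max 1 p)) (tmin := -(π / 2))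
      (tmax := π / 2) ⟨0, h0⟩ ((a + b) / 2) (r + 1) r (1 / 4) 1 := by
    refine ⟨fun θ _ => ?_, fun p _ => ?_, fun θ _ p _ => ?_, ?_⟩
    · refine LipschitzOnWith.of_dist_le_mul fun p _ q _ => ?_
      rw [dist_eq, dist_eq, NNReal.coe_one, one_mul]
      exact (abs_polarSlope_sub_le he (le_max_left _ _) (le_max_left _ _)).trans
        (abs_max_sub_max_le_abs _ _ _ |>.trans_eq' (by rw [max_comm 1, max_comm 1]))
    · refine Continuous.continuousOn ?_
      have hc := continuous_angularSpeed_comp (e := e) (continuous_const (y := max 1 p))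
        fun θ => (by positivity)
      unfold polarSlope
      refine Continuous.div (by fun_prop) hc fun θ => ?_
      have := angularSpeed_pos (θ := θ) he (le_max_left 1 p)
      linarith
    · have := abs_polarSlope_le (θ := θ) he (le_max_left 1 p)
      simpa using this
    · simp only [sub_zero, zero_sub, neg_neg, max_self, NNReal.coe_add, NNReal.coe_one]
      push_cast
      linarith
  obtain ⟨α, hα, L', hL⟩ := hPL.exists_forall_mem_closedBall_eq_hasDerivWithinAt_lipschitzOnWith
  have hball : Metric.closedBall ((a + b) / 2) r = Icc a b := by
    rw [closedBall_eq_Icc]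
    rw [show (r : ℝ) = (b - a) / 2 from rfl]
    congr 1 <;> ring
  rw [hball] at hα hL
  refine ⟨α, fun s hs => ?_, fun θ hθ => (hL θ hθ).continuousOn⟩
  obtain ⟨h1, h2⟩ := hα s hs
  simp only at h1
  have h3 : ∀ θ ∈ Icc (-(π / 2)) (π / 2), 1 ≤ α s θ := by
    intro θ hθ
    have h4 := (convex_Icc (-(π / 2)) (π / 2)).norm_image_sub_le_of_norm_hasDerivWithin_le h2
      (fun θ _ => by
        rw [norm_eq_abs]
        exact abs_polarSlope_le (θ := θ) he (le_max_left 1 (α s θ))) h0 hθ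
    rw [norm_eq_abs, norm_eq_abs, h1, sub_zero] at h4
    have h5 : |θ| ≤ 2 := abs_le.2 ⟨by linarith [hθ.1], by linarith [hθ.2]⟩
    have h6 := (abs_le.1 h4).1
    linarith [hs.1]
  refine ⟨h1, h3, fun θ hθ => ?_⟩
  simpa only [max_eq_right (h3 θ hθ)] using h2 θ hθ

/-- The sign of the change of the radius over half a turn through `((n + 1) π, 0)`. -/
theorem half_turn_sign {e : ℝ} (n : ℕ) (he0 : 0 < e) (he : e ≤ 1 / 10) {ρ : ℝ → ℝ}
    (h0 : ρ 0 = (n + 1) * π) (h1 : ∀ θ ∈ Icc (-(π / 2)) (π / 2), 1 ≤ ρ θ)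
    (hρ : ∀ θ ∈ Icc (-(π / 2)) (π / 2),
      HasDerivWithinAt ρ (polarSlope e θ (ρ θ)) (Icc (-(π / 2)) (π / 2)) θ) :
    0 < (-1) ^ n * (ρ (π / 2) - ρ (-(π / 2))) := by
  have hpi := pi_pos
  have hsub : Icc 0 (π / 2) ⊆ Icc (-(π / 2)) (π / 2) := Icc_subset_Icc_left (by linarith)
  have hneg : ∀ θ ∈ Icc 0 (π / 2), -θ ∈ Icc (-(π / 2)) (π / 2) := fun θ hθ =>
    ⟨by linarith [hθ.2], by linarith [hθ.1]⟩
  have hea : |e| ≤ 1 / 10 := by rwa [abs_of_pos he0]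
  obtain ⟨I, hI, hI'⟩ := exists_energy_change_quarter_turn n hea h0
    (fun θ hθ => h1 θ (hsub hθ)) fun θ hθ => (hρ θ (hsub hθ)).mono hsub
  -- Reversing the angle replaces `e` by `-e`. The backward quarter turn therefore changes the
  -- energy by `-4 e J`, and the two contributions add up.
  obtain ⟨J, hJ, hJ'⟩ := exists_energy_change_quarter_turn (e := -e) (ρ := fun θ => ρ (-θ)) n
    (by rwa [abs_neg]) (by simpa using h0) (fun θ hθ => h1 _ (hneg θ hθ)) fun θ hθ => by
      have h := (hρ _ (hneg θ hθ)).scomp θ (hasDerivAt_neg θ).hasDerivWithinAt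
        (s := Icc 0 (π / 2)) hneg
      refine h.congr_deriv ?_
      simp only [polarSlope, angularSpeed, sin_neg, cos_neg, smul_eq_mul]
      ring
  simp only [neg_zero] at hJ'
  have hsum : 0 < ρ (π / 2) + ρ (-(π / 2)) := by
    linarith [h1 (π / 2) ⟨by linarith, le_rfl⟩, h1 (-(π / 2)) ⟨le_rfl, by linarith⟩]
  have hprod : 0 < (-1) ^ n * (ρ (π / 2) - ρ (-(π / 2))) * (ρ (π / 2) + ρ (-(π / 2))) := by
    have : (-1) ^ n * (ρ (π / 2) - ρ (-(π / 2))) * (ρ (π / 2) + ρ (-(π / 2))) =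
        4 * e * ((-1) ^ n * I + (-1) ^ n * J) := by
      linear_combination (-1) ^ n * (hI' - hJ')
    rw [this]
    positivity
  exact pos_of_mul_pos_left hprod hsum.le

/-- The field is odd, so the polar equation has period `π` and a half turn with equal end radii
suffices for a closed orbit. -/
theorem polarSlope_periodic (e p : ℝ) : Function.Periodic (fun θ => polarSlope e θ p) π := by
  intro θ
  simp [polarSlope, angularSpeed]

theorem angularSpeed_periodic (e p : ℝ) : Function.Periodic (fun θ => angularSpeed e θ p) π := by
  intro θ
  simp [angularSpeed]

/-- A solution of the polar equation over half a turn which closes up extends periodically. -/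
theorem exists_periodic_extension {e : ℝ} {ρ : ℝ → ℝ}
    (h1 : ∀ θ ∈ Icc (-(π / 2)) (π / 2), 1 ≤ ρ θ)
    (hρ : ∀ θ ∈ Icc (-(π / 2)) (π / 2),
      HasDerivWithinAt ρ (polarSlope e θ (ρ θ)) (Icc (-(π / 2)) (π / 2)) θ)
    (hclose : ρ (π / 2) = ρ (-(π / 2))) :
    ∃ ρ' : ℝ → ℝ, ρ' 0 = ρ 0 ∧ Function.Periodic ρ' π ∧ (∀ θ, 1 ≤ ρ' θ) ∧
      ∀ θ, HasDerivAt ρ' (polarSlope e θ (ρ' θ)) θ := by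
  have hpi := pi_pos
  set ρ' : ℝ → ℝ := fun θ => ρ (toIcoMod hpi (-(π / 2)) θ) with hρ'
  have hend : -(π / 2) + π = π / 2 := by ring
  have hIco : ∀ θ, toIcoMod hpi (-(π / 2)) θ ∈ Ico (-(π / 2)) (π / 2) := fun θ => by
    have := toIcoMod_mem_Ico hpi (-(π / 2)) θ
    rwa [hend] at this
  have hper : Function.Periodic ρ' π := fun θ => by simp only [hρ', toIcoMod_add_right]
  have heq : ∀ θ ∈ Icc (-(π / 2)) (π / 2), ρ' θ = ρ θ := by
    intro θ hθ
    rcases hθ.2.lt_or_eq with h | h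
    · have : toIcoMod hpi (-(π / 2)) θ = θ :=
        (toIcoMod_eq_self hpi).2 ⟨hθ.1, by rwa [hend]⟩
      simp only [hρ', this]
    · rw [h, ← hend, hper, hend, hclose]
      have : toIcoMod hpi (-(π / 2)) (-(π / 2)) = -(π / 2) :=
        (toIcoMod_eq_self hpi).2 ⟨le_rfl, by linarith⟩
      simp only [hρ', this]
  have hd : ∀ θ ∈ Icc (-(π / 2)) (π / 2),
      HasDerivWithinAt ρ' (polarSlope e θ (ρ' θ)) (Icc (-(π / 2)) (π / 2)) θ := fun θ hθ => by
    rw [heq θ hθ]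
    exact (hρ θ hθ).congr heq (heq θ hθ)
  have hd' : ∀ θ ∈ Ico (-(π / 2)) (π / 2), HasDerivAt ρ' (polarSlope e θ (ρ' θ)) θ := by
    intro θ hθ
    rcases hθ.1.lt_or_eq with h | h
    · exact (hd θ (Ico_subset_Icc_self hθ)).hasDerivAt (Icc_mem_nhds h hθ.2)
    · subst h
      have hR := hd (-(π / 2)) ⟨le_rfl, by linarith⟩
      have hL := hd (π / 2) ⟨by linarith, le_rfl⟩
      -- At the seam both one-sided slopes vanish with `cos (±π/2)`.
      have hs : polarSlope e (π / 2) (ρ' (π / 2)) = polarSlope e (-(π / 2)) (ρ' (-(π / 2))) := by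
        simp [polarSlope]
      have hL2 : HasDerivWithinAt ρ' (polarSlope e (-(π / 2)) (ρ' (-(π / 2))))
          (Icc (-(π / 2)) (π / 2)) (-(π / 2) + π) := by
        rw [hend, ← hs]
        exact hL
      have hmaps : MapsTo (fun x => id x + π) (Icc (-(π / 2) - π) (-(π / 2)))
          (Icc (-(π / 2)) (π / 2)) := fun x hx =>
        ⟨by simp only [id]; linarith [hx.1], by simp only [id]; linarith [hx.2]⟩
      have hL' := HasDerivWithinAt.scomp (-(π / 2)) hL2
        ((hasDerivAt_id (-(π / 2))).add_const π).hasDerivWithinAt hmaps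
      have hfun : (ρ' ∘ fun x => id x + π) = ρ' := funext hper
      rw [hfun, one_smul] at hL'
      refine (hL'.union hR).hasDerivAt ?_
      refine Filter.mem_of_superset (Icc_mem_nhds (a := -(π / 2) - π) (b := π / 2)
        (by linarith) (by linarith)) fun x hx => ?_
      rcases le_total x (-(π / 2)) with hx' | hx'
      · exact Or.inl ⟨hx.1, hx'⟩
      · exact Or.inr ⟨hx', hx.2⟩
  refine ⟨ρ', heq 0 ⟨by linarith, by linarith⟩, hper,
    fun θ => h1 _ (Ico_subset_Icc_self (hIco θ)), fun θ => ?_⟩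
  obtain ⟨k, hk⟩ : ∃ k : ℤ, θ - k • π ∈ Ico (-(π / 2)) (π / 2) :=
    ⟨toIcoDiv hpi (-(π / 2)) θ, hIco θ⟩
  have h := (hd' _ hk).comp_sub_const θ (k • π)
  have hfun : (fun x => ρ' (x - k • π)) = ρ' := funext fun x => hper.sub_zsmul_eq k
  rw [hfun, hper.sub_zsmul_eq k] at h
  have hs : polarSlope e (θ - k • π) (ρ' θ) = polarSlope e θ (ρ' θ) :=
    (polarSlope_periodic e (ρ' θ)).sub_zsmul_eq k
  rwa [hs] at h

/-- A positive periodic speed on the circle is the speed of a periodic motion. -/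
theorem exists_periodic_motion {w : ℝ → ℝ} {M p : ℝ} (hw : Continuous w) (hp : 0 < p)
    (hpos : ∀ θ, 0 < w θ) (hM : ∀ θ, w θ ≤ M) (hper : Function.Periodic w p) :
    ∃ (φ : ℝ → ℝ) (T : ℝ), 0 < T ∧ φ 0 = 0 ∧ (∀ t, HasDerivAt φ (w (φ t)) t) ∧
      Function.Surjective φ ∧ ∀ t, φ (t + T) = φ t + p := by
  have hM0 : 0 < M := (hpos 0).trans_le (hM 0)
  have hc : Continuous fun θ => (w θ)⁻¹ := hw.inv₀ fun θ => (hpos θ).ne'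
  -- The time needed to reach angle `θ`; the motion is its inverse. The comparison with `θ / M`
  -- below shows that `F` is onto.
  set F : ℝ → ℝ := fun θ => ∫ x in (0 : ℝ)..θ, (w x)⁻¹ with hF
  have hFd : ∀ θ, HasDerivAt F (w θ)⁻¹ θ := fun θ =>
    intervalIntegral.integral_hasDerivAt_right (hc.intervalIntegrable _ _)
      (hc.stronglyMeasurableAtFilter _ _) hc.continuousAt
  have hF0 : F 0 = 0 := by simp [hF]
  have hmono : StrictMono F := strictMono_of_deriv_pos fun θ => by
    rw [(hFd θ).deriv]; exact inv_pos.2 (hpos θ)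
  have hmono2 : Monotone fun θ => F θ - θ * M⁻¹ :=
    monotone_of_deriv_nonneg (fun θ => ((hFd θ).sub
      ((hasDerivAt_id θ).mul_const M⁻¹)).differentiableAt) fun θ => by
      rw [show deriv (fun θ => F θ - θ * M⁻¹) θ = _ from
        ((hFd θ).sub ((hasDerivAt_id θ).mul_const M⁻¹)).deriv, one_mul, sub_nonneg]
      exact inv_anti₀ (hpos θ) (hM θ)
  have hFc : Continuous F := continuous_iff_continuousAt.2 fun θ => (hFd θ).continuousAt
  have hsurj : Function.Surjective F := by
    have hlin : Filter.Tendsto (fun θ : ℝ => θ * M⁻¹) Filter.atTop Filter.atTop :=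
      Filter.tendsto_id.atTop_mul_const (inv_pos.2 hM0)
    have hlin' : Filter.Tendsto (fun θ : ℝ => θ * M⁻¹) Filter.atBot Filter.atBot :=
      Filter.tendsto_id.atBot_mul_const (inv_pos.2 hM0)
    refine hFc.surjective ?_ ?_
    · refine Filter.tendsto_atTop_mono' _ ?_ hlin
      filter_upwards [Filter.eventually_ge_atTop 0] with θ hθ
      have := hmono2 hθ
      simp only [hF0] at this
      linarith
    · refine Filter.tendsto_atBot_mono' _ ?_ hlin'
      filter_upwards [Filter.eventually_le_atBot 0] with θ hθ
      have := hmono2 hθ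
      simp only [hF0] at this
      linarith
  set G := hmono.orderIsoOfSurjective F hsurj with hG
  have hFG : ∀ t, F (G.symm t) = t := fun t => G.apply_symm_apply t
  have hGF : ∀ θ, G.symm (F θ) = θ := fun θ => G.symm_apply_apply θ
  have hFper : ∀ θ, F (θ + p) = F θ + F p := by
    intro θ
    have hper' : Function.Periodic (fun θ => (w θ)⁻¹) p := fun θ => by simp only [hper θ]
    have h1 := hper'.intervalIntegral_add_eq θ 0
    rw [zero_add] at h1
    rw [hF]
    simp only
    rw [← intervalIntegral.integral_add_adjacent_intervals (b := θ)
      (hc.intervalIntegrable _ _) (hc.intervalIntegrable _ _), h1]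
  refine ⟨G.symm, F p, ?_, ?_, fun t => ?_, G.symm.surjective, fun t => ?_⟩
  · rw [← hF0]; exact hmono hp
  · conv_lhs => rw [← hF0]
    exact hGF 0
  · have := HasDerivAt.of_local_left_inverse (f := F) (g := G.symm) G.symm.continuous.continuousAt
      (hFd (G.symm t)) (inv_ne_zero (hpos _).ne') (Filter.Eventually.of_forall hFG)
    rwa [inv_inv] at this
  · conv_lhs => rw [← hFG t, ← hFper, hGF]

/-- A closed solution of the polar equation is a periodic orbit of the example. -/
theorem mem_periodicOrbits_of_periodic {e : ℝ} (he : |e| ≤ 1 / 10) {ρ : ℝ → ℝ}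
    (hper : Function.Periodic ρ π) (h1 : ∀ θ, 1 ≤ ρ θ)
    (hρ : ∀ θ, HasDerivAt ρ (polarSlope e θ (ρ θ)) θ) :
    range (fun θ => polarPoint (ρ θ / 2) θ) ∈ periodicOrbits (exampleField e) := by
  have hρ0 : ∀ θ, 0 < ρ θ := fun θ => by linarith [h1 θ]
  have hρc : Continuous ρ := continuous_iff_continuousAt.2 fun θ => (hρ θ).continuousAt
  have hwper : Function.Periodic (fun θ => angularSpeed e θ (ρ θ)) π := fun θ => by
    simp only [hper θ]
    exact angularSpeed_periodic e (ρ θ) θ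
  -- Radius and speed have period `π`, but the point returns only after a full turn, hence the
  -- period `2 * π`.
  obtain ⟨φ, T, hT, hφ0, hφ, hsurj, hφT⟩ := exists_periodic_motion (M := 6 / 5)
    (p := 2 * π) (continuous_angularSpeed_comp (e := e) hρc fun θ => (hρ0 θ).ne') (by positivity)
    (fun θ => by linarith [angularSpeed_pos (θ := θ) he (h1 θ)])
    (fun θ => by linarith [(abs_le.1 (abs_angularSpeed_sub_one_le (θ := θ) he (h1 θ))).2])
    (by simpa using hwper.nat_mul 2)
  refine ⟨fun t => polarPoint (ρ (φ t) / 2) (φ t), T, hT, fun t => ?_, fun t => ?_, ?_, ?_⟩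
  · have hD : angularSpeed e (φ t) (ρ (φ t)) ≠ 0 := by
      linarith [angularSpeed_pos (θ := φ t) he (h1 (φ t))]
    have h2 : HasDerivAt (fun t => ρ (φ t) * cos (φ t)) _ t :=
      (hasDerivWithinAt_univ.1 (hasDerivWithinAt_mul_cos hD (hρ0 _).ne'
        (hρ (φ t)).hasDerivWithinAt)).comp t (hφ t)
    have h3 : HasDerivAt (fun t => ρ (φ t) * sin (φ t)) _ t :=
      (hasDerivWithinAt_univ.1 (hasDerivWithinAt_mul_sin hD (hρ0 _).ne'
        (hρ (φ t)).hasDerivWithinAt)).comp t (hφ t)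
    refine hasDerivAt_pi.2 fun i => ?_
    fin_cases i
    · have : (fun t => ρ (φ t) * cos (φ t)) =
          fun t => polarPoint (ρ (φ t) / 2) (φ t) 0 := by
        ext t; simp [polarPoint, mul_div_cancel₀]
      rw [this] at h2
      refine h2.congr_deriv ?_
      simp [exampleField, polarPoint, mul_div_cancel₀, div_mul_cancel₀ _ hD]
      ring
    · have : (fun t => -(ρ (φ t) * sin (φ t))) =
          fun t => polarPoint (ρ (φ t) / 2) (φ t) 1 := by
        ext t; simp [polarPoint, mul_div_cancel₀]
      have h4 := h3.neg
      rw [show (-fun t => ρ (φ t) * sin (φ t)) = _ from this] at h4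
      refine h4.congr_deriv ?_
      simp [exampleField, polarPoint, mul_div_cancel₀, div_mul_cancel₀ _ hD]
  · have : ρ (φ t + 2 * π) = ρ (φ t) := by
      have := hper.nat_mul 2 (φ t)
      simpa using this
    simp only [hφT, this, polarPoint_periodic _ (φ t)]
  · obtain ⟨t, ht⟩ := hsurj π
    refine ⟨t, fun h => ?_⟩
    have h2 := congrFun h 0
    simp only [ht, hφ0, polarPoint, Matrix.cons_val_zero, cos_pi, cos_zero] at h2
    linarith [hρ0 π, hρ0 0]
  · exact (hsurj.range_comp (fun θ => polarPoint (ρ θ / 2) θ)).symm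

/-- The drift over half a turn is continuous in the radius at angle `0` and changes sign between
consecutive multiples of `π`. -/
theorem exists_periodic_polar_solution {e : ℝ} (n : ℕ) (he0 : 0 < e) (he : e ≤ 1 / 10) :
    ∃ ρ : ℝ → ℝ, ρ 0 ∈ Ioo ((n + 1) * π) ((n + 2) * π) ∧ Function.Periodic ρ π ∧
      (∀ θ, 1 ≤ ρ θ) ∧ ∀ θ, HasDerivAt ρ (polarSlope e θ (ρ θ)) θ := by
  have hpi := pi_gt_three
  have hn : (0 : ℝ) ≤ n := n.cast_nonneg
  have hab : (n + 1) * π ≤ (n + 2) * π := by gcongr; norm_num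
  obtain ⟨α, hα, hαc⟩ := exists_polar_flow (e := e) (by rwa [abs_of_pos he0]) ((n + 1) * π)
    ((n + 2) * π) (by nlinarith) hab
  have hsign : ∀ m : ℕ, ((m : ℝ) + 1) * π ∈ Icc ((n + 1) * π) ((n + 2) * π) →
      0 < (-1) ^ m * (α ((m + 1) * π) (π / 2) - α ((m + 1) * π) (-(π / 2))) := fun m hm =>
    half_turn_sign m he0 he (hα _ hm).1 (hα _ hm).2.1 (hα _ hm).2.2
  obtain ⟨s, hs, hs0⟩ := exists_zero_of_alternating_sign
    (f := fun s => α s (π / 2) - α s (-(π / 2))) n hab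
    ((hαc _ ⟨by linarith, le_rfl⟩).sub (hαc _ ⟨le_rfl, by linarith⟩))
    (hsign n ⟨le_rfl, hab⟩) (by
      have := hsign (n + 1)
      push_cast at this
      rw [show (n : ℝ) + 1 + 1 = n + 2 by ring] at this
      exact this ⟨hab, le_rfl⟩)
  obtain ⟨h1, h2, h3⟩ := hα s (Ioo_subset_Icc_self hs)
  obtain ⟨ρ, hρ0, hρ⟩ := exists_periodic_extension h2 h3 (sub_eq_zero.1 hs0)
  exact ⟨ρ, by rw [hρ0, h1]; exact hs, hρ⟩

/-- The example has infinitely many periodic orbits for `0 < e ≤ 1 / 10`. -/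
theorem infinite_periodicOrbits_exampleField {e : ℝ} (he0 : 0 < e) (he : e ≤ 1 / 10) :
    (periodicOrbits (exampleField e)).Infinite := by
  choose ρ hρ0 hper h1 hρ using fun n => exists_periodic_polar_solution n he0 he
  refine Set.infinite_of_injective_forall_mem
    (f := fun n => range fun θ => polarPoint (ρ n θ / 2) θ) ?_ fun n =>
    mem_periodicOrbits_of_periodic (by rwa [abs_of_pos he0]) (hper n) (h1 n) (hρ n)
  intro n m h
  have hmem : polarPoint (ρ n 0 / 2) 0 ∈ range fun θ => polarPoint (ρ m θ / 2) θ := by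
    have h' : (range fun θ => polarPoint (ρ n θ / 2) θ) =
      range fun θ => polarPoint (ρ m θ / 2) θ := h
    rw [← h']
    exact mem_range_self 0
  obtain ⟨θ, hθ⟩ := hmem
  -- Distinctness: such an orbit meets the first axis only at angles `kπ`, always at radius `ρ 0`,
  -- and these radii lie in disjoint intervals for different `n`.
  have hsin := congrFun hθ 1
  simp only [polarPoint, Matrix.cons_val_one, Matrix.cons_val_zero, sin_zero, mul_zero, neg_zero,
    neg_eq_zero, mul_eq_zero] at hsin
  have hsin' : sin θ = 0 := by
    rcases hsin with (h | h) | h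
    · norm_num at h
    · linarith [h1 m θ]
    · exact h
  obtain ⟨k, rfl⟩ := sin_eq_zero_iff.1 hsin'
  have hk : ρ m (k * π) = ρ m 0 := by
    have := (hper m).int_mul k 0
    rwa [zero_add] at this
  have hsq := polarPoint_sq (ρ m (k * π) / 2) (k * π)
  rw [show polarPoint (ρ m (k * π) / 2) (k * π) = polarPoint (ρ n 0 / 2) 0 from hθ,
    polarPoint_sq, hk, sq_eq_sq₀ (by linarith [h1 n 0]) (by linarith [h1 m 0])] at hsq
  have heq : ρ n 0 = ρ m 0 := by linarith
  have hn := hρ0 n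
  have hm := hρ0 m
  rw [heq] at hn
  have hlt1 : ((n : ℝ) + 1) < m + 2 := lt_of_mul_lt_mul_right (hn.1.trans hm.2) pi_pos.le
  have hlt2 : ((m : ℝ) + 1) < n + 2 := lt_of_mul_lt_mul_right (hm.1.trans hn.2) pi_pos.le
  have h3 : n + 1 < m + 2 := by exact_mod_cast hlt1
  have h4 : m + 1 < n + 2 := by exact_mod_cast hlt2
  omega

end LimitCycles

/-! ### Periodic orbits of rotation equivariant planar fields -/

section EquivariantFields

open Real Set

/-- Every point is the rotation of a point of the positive first axis. -/
theorem exists_eq_rot (x : Fin 2 → ℝ) : ∃ θ, x = rot θ ![√(x 0 ^ 2 + x 1 ^ 2), 0] := by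
  set z : ℂ := ⟨x 0, x 1⟩ with hz
  have hnorm : ‖z‖ = √(x 0 ^ 2 + x 1 ^ 2) := by
    rw [Complex.norm_def, Complex.normSq_apply, sq, sq]
  refine ⟨-z.arg, ?_⟩
  have h0 := Complex.norm_mul_cos_arg z
  have h1 := Complex.norm_mul_sin_arg z
  rw [hnorm] at h0 h1
  rw [rot_eq]
  ext i
  fin_cases i
  · simp only [Fin.zero_eta, Matrix.cons_val_zero, Matrix.cons_val_one, cos_neg, mul_zero, add_zero]
    rw [mul_comm, h0]
  · simp only [Fin.mk_one, Matrix.cons_val_zero, Matrix.cons_val_one, sin_neg, mul_zero, zero_sub,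
      neg_mul, neg_neg]
    rw [mul_comm, h1]

/-- Periodic solutions of scalar autonomous equations are constant. -/
theorem apply_eq_zero_of_periodic {W ψ : ℝ → ℝ} {T : ℝ} (hψ : Continuous ψ) (hT : 0 < T)
    (hW : ∀ t, HasDerivAt W (ψ (W t)) t) (hper : ∀ t, W (t + T) = W t) (t : ℝ) :
    ψ (W t) = 0 := by
  -- `Ψ ∘ W` has derivative `ψ(W)² ≥ 0` and is periodic, hence constant.
  set Ψ : ℝ → ℝ := fun v => ∫ x in (0 : ℝ)..v, ψ x
  have hΨ : ∀ v, HasDerivAt Ψ (ψ v) v := fun v =>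
    intervalIntegral.integral_hasDerivAt_right (hψ.intervalIntegrable _ _)
      (hψ.stronglyMeasurableAtFilter _ _) hψ.continuousAt
  have hd : ∀ t, HasDerivAt (fun t => Ψ (W t)) (ψ (W t) * ψ (W t)) t := fun t =>
    (hΨ (W t)).comp t (hW t)
  have hmono : Monotone fun t => Ψ (W t) :=
    monotone_of_deriv_nonneg (fun t => (hd t).differentiableAt) fun t => by
      rw [(hd t).deriv]; exact mul_self_nonneg _
  have hconst : ∀ s ∈ Icc t (t + T), Ψ (W s) = Ψ (W t) := fun s hs => by
    refine le_antisymm ?_ (hmono hs.1)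
    have := hmono hs.2
    simpa only [hper] using this
  have h1 : HasDerivWithinAt (fun t => Ψ (W t)) 0 (Icc t (t + T)) t :=
    (hasDerivWithinAt_const t _ (Ψ (W t))).congr hconst rfl
  have h2 := (uniqueDiffOn_Icc (by linarith : t < t + T) t ⟨le_rfl, by linarith⟩).eq_deriv _
    (hd t).hasDerivWithinAt h1
  exact mul_self_eq_zero.1 h2

/-- A rotation equivariant vector field on the plane has only finitely many periodic orbits if its
radial part is a nonzero polynomial. -/
theorem finite_periodicOrbits_of_equivariant {F : (Fin 2 → ℝ) → (Fin 2 → ℝ)}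
    (hF : ∀ t x, F (rot t x) = rot t (F x)) {P : Polynomial ℝ} (hP : P ≠ 0)
    (hFP : ∀ s, F ![s, 0] 0 = P.eval s) : (periodicOrbits F).Finite := by
  refine (P.roots.toFinset.finite_toSet.image
    fun s : ℝ => {x : Fin 2 → ℝ | x 0 ^ 2 + x 1 ^ 2 = s ^ 2}).subset ?_
  rintro C ⟨γ, T, hT, hγ, hper, ⟨t₁, ht₁⟩, rfl⟩
  -- By equivariance the squared radius obeys an autonomous scalar equation, so it is constant on a
  -- periodic orbit and its root is a zero of `P`.
  set W : ℝ → ℝ := fun t => γ t 0 ^ 2 + γ t 1 ^ 2 with hW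
  have hWd : ∀ t, HasDerivAt W (2 * √(W t) * P.eval √(W t)) t := by
    intro t
    have hγi := fun i => hasDerivAt_pi.1 (hγ t) i
    refine (((hγi 0).pow 2).add ((hγi 1).pow 2)).congr_deriv ?_
    obtain ⟨θ, hθ⟩ := exists_eq_rot (γ t)
    have hs : √(γ t 0 ^ 2 + γ t 1 ^ 2) = √(W t) := rfl
    rw [hs] at hθ
    rw [← hFP, hθ, hF]
    generalize F ![√(W t), 0] = y
    simp only [rot_eq, Matrix.cons_val_zero, Matrix.cons_val_one]
    push_cast
    linear_combination 2 * √(W t) * y 0 * sin_sq_add_cos_sq θ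
  have hWper : ∀ t, W (t + T) = W t := fun t => by simp only [hW, hper]
  have hzero := apply_eq_zero_of_periodic (ψ := fun v => 2 * √v * P.eval √v)
    (by fun_prop) hT hWd hWper
  have hconst : ∀ t, W t = W 0 := fun t =>
    is_const_of_deriv_eq_zero (fun t => (hWd t).differentiableAt)
      (fun t => by rw [(hWd t).deriv]; exact hzero t) t 0
  set s := √(W 0) with hs
  have hW0 : 0 ≤ W 0 := by positivity
  have hrot : ∀ t, ∃ θ, γ t = rot θ ![s, 0] := fun t => by
    obtain ⟨θ, hθ⟩ := exists_eq_rot (γ t)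
    have : √(γ t 0 ^ 2 + γ t 1 ^ 2) = s := by rw [hs, ← hconst t]
    rw [this] at hθ
    exact ⟨θ, hθ⟩
  have hs0 : s ≠ 0 := by
    intro h
    have : ∀ t, γ t = 0 := fun t => by
      obtain ⟨θ, hθ⟩ := hrot t
      rw [hθ, h, show (![0, 0] : Fin 2 → ℝ) = 0 by ext i; fin_cases i <;> rfl, rot_apply_zero]
    exact ht₁ (by rw [this, this])
  have hsP : P.eval s = 0 := by
    have := hzero 0
    simp only [mul_eq_zero, OfNat.ofNat_ne_zero, false_or] at this
    exact this.resolve_left hs0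
  -- On the invariant circle the field is `κ A`. The motion is a uniform rotation, and `κ ≠ 0` makes
  -- the orbit the whole circle.
  set κ := -(F ![s, 0] 1 / s) with hκ
  have hFs : F ![s, 0] = κ • (exampleMatrix *ᵥ ![s, 0]) := by
    rw [exampleMatrix_mulVec]
    ext i
    fin_cases i
    · simp [hFP, hsP]
    · simp [hκ, hs0]
  have hγ' : ∀ t, HasDerivAt γ (κ • (exampleMatrix *ᵥ γ t)) t := by
    intro t
    obtain ⟨θ, hθ⟩ := hrot t
    have h := hγ t
    rwa [hθ, hF, hFs, rot_smul, ← exampleMatrix_mulVec_rot, ← hθ] at h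
  have hsol : ∀ t, γ t = rot (κ * t) (γ 0) := by
    intro t
    have hd : ∀ t, HasDerivAt (fun t => rot (-(κ * t)) (γ t)) 0 t := fun t => by
      refine (hasDerivAt_rot_comp ((hasDerivAt_id t).const_mul κ).neg (hγ' t)).congr_deriv ?_
      rw [rot_smul, exampleMatrix_mulVec_rot]
      simp
    have h := is_const_of_deriv_eq_zero (fun t => (hd t).differentiableAt)
      (fun t => (hd t).deriv) t 0
    simp only [mul_zero, neg_zero, rot_zero] at h
    rw [← h, rot_rot_neg]
  have hκ0 : κ ≠ 0 := fun h => ht₁ (by rw [hsol t₁, h]; simp)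
  refine ⟨s, ?_, ?_⟩
  · simp [hP, hsP]
  · ext x
    constructor
    · intro hx
      obtain ⟨θ, hθ⟩ := exists_eq_rot x
      obtain ⟨θ₀, hθ₀⟩ := hrot 0
      rw [show x 0 ^ 2 + x 1 ^ 2 = s ^ 2 from hx, sqrt_sq (sqrt_nonneg _)] at hθ
      refine ⟨(θ - θ₀) / κ, ?_⟩
      rw [hsol, mul_div_cancel₀ _ hκ0, hθ₀, rot_rot, sub_add_cancel, hθ]
    · rintro ⟨t, rfl⟩
      change W t = s ^ 2
      rw [hconst t, hs, sq_sqrt hW0]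

end EquivariantFields

/-! ### Differentiating pointwise asymptotic estimates in a polynomial parameter -/

section PolynomialFamilies

open Asymptotics Filter

/-- The algebra of differentiable real functions. -/
def differentiableFunctions (E : Type*) [NormedAddCommGroup E] [NormedSpace ℝ E] :
    Subring (E → ℝ) where
  carrier := {f | Differentiable ℝ f}
  zero_mem' := differentiable_const 0
  one_mem' := differentiable_const 1
  add_mem' := Differentiable.add
  neg_mem' := Differentiable.neg
  mul_mem' := Differentiable.mul

variable {E : Type*} [NormedAddCommGroup E] [NormedSpace ℝ E]

/-- The evaluation of differentiable functions at a point. -/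
def evalHom (x : E) : differentiableFunctions E →+* ℝ :=
  (Pi.evalRingHom (fun _ : E => ℝ) x).comp (differentiableFunctions E).subtype

/-- A function of `(δ, x)` which is a polynomial in `δ` with coefficients differentiable in `x`. -/
def IsPolynomialFamily (f : ℝ → E → ℝ) : Prop :=
  ∃ P : Polynomial (differentiableFunctions E), ∀ δ x, f δ x = P.eval₂ (evalHom x) δ

namespace IsPolynomialFamily

variable {f g : ℝ → E → ℝ}

theorem of_differentiable {c : E → ℝ} (hc : Differentiable ℝ c) :
    IsPolynomialFamily fun _ : ℝ => c :=
  ⟨Polynomial.C ⟨c, hc⟩, fun δ x => by simp [evalHom]⟩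

theorem pow_param (n : ℕ) : IsPolynomialFamily fun (δ : ℝ) (_ : E) => δ ^ n :=
  ⟨Polynomial.X ^ n, fun δ x => by simp⟩

theorem add (hf : IsPolynomialFamily f) (hg : IsPolynomialFamily g) :
    IsPolynomialFamily fun δ x => f δ x + g δ x := by
  obtain ⟨P, hP⟩ := hf
  obtain ⟨Q, hQ⟩ := hg
  exact ⟨P + Q, fun δ x => by simp only [hP, hQ, Polynomial.eval₂_add]⟩

theorem sub (hf : IsPolynomialFamily f) (hg : IsPolynomialFamily g) :
    IsPolynomialFamily fun δ x => f δ x - g δ x := by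
  obtain ⟨P, hP⟩ := hf
  obtain ⟨Q, hQ⟩ := hg
  exact ⟨P - Q, fun δ x => by simp only [hP, hQ, Polynomial.eval₂_sub]⟩

theorem mul (hf : IsPolynomialFamily f) (hg : IsPolynomialFamily g) :
    IsPolynomialFamily fun δ x => f δ x * g δ x := by
  obtain ⟨P, hP⟩ := hf
  obtain ⟨Q, hQ⟩ := hg
  exact ⟨P * Q, fun δ x => by simp only [hP, hQ, Polynomial.eval₂_mul]⟩

theorem pow (hf : IsPolynomialFamily f) (n : ℕ) : IsPolynomialFamily fun δ x => f δ x ^ n := by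
  obtain ⟨P, hP⟩ := hf
  exact ⟨P ^ n, fun δ x => by simp only [hP, Polynomial.eval₂_pow]⟩

theorem sum {ι : Type*} (s : Finset ι) {f : ι → ℝ → E → ℝ}
    (hf : ∀ i ∈ s, IsPolynomialFamily (f i)) :
    IsPolynomialFamily fun δ x => ∑ i ∈ s, f i δ x := by
  classical
  induction s using Finset.induction_on with
  | empty => simpa using of_differentiable (E := E) (differentiable_const (0 : ℝ))
  | insert i s hi ih =>
    simp only [Finset.sum_insert hi]
    exact (hf i (Finset.mem_insert_self _ _)).add
      (ih fun j hj => hf j (Finset.mem_insert_of_mem hj))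

end IsPolynomialFamily

theorem pow_isBigO_pow {n j : ℕ} (h : n ≤ j) :
    (fun δ : ℝ => δ ^ j) =O[𝓝 0] fun δ : ℝ => δ ^ n := by
  obtain ⟨k, rfl⟩ := Nat.exists_eq_add_of_le h
  have h1 : (fun δ : ℝ => δ ^ k) =O[𝓝 0] fun _ => (1 : ℝ) :=
    (continuous_pow k).continuousAt.tendsto.isBigO_one ℝ
  simpa [pow_add] using (isBigO_refl (fun δ : ℝ => δ ^ n) (𝓝 0)).mul h1

/-- One factor is split off at a time: dividing by `δ^n` off the origin leaves a cofactor that is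
`O(δ)`, which vanishes at `0` by continuity. -/
theorem X_pow_dvd_of_isBigO {p : Polynomial ℝ} (n : ℕ)
    (h : (fun δ : ℝ => p.eval δ) =O[𝓝 0] fun δ : ℝ => δ ^ n) : Polynomial.X ^ n ∣ p := by
  induction n with
  | zero => simp
  | succ n ih =>
    obtain ⟨q, rfl⟩ := ih (h.trans (pow_isBigO_pow n.le_succ))
    have hq : (fun δ : ℝ => q.eval δ) =O[𝓝[≠] 0] fun δ : ℝ => δ := by
      obtain ⟨C, hC⟩ := h.bound
      refine IsBigO.of_bound C ?_
      filter_upwards [nhdsWithin_le_nhds hC, self_mem_nhdsWithin] with δ h1 h2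
      have h3 : 0 < ‖δ‖ ^ n := pow_pos (norm_pos_iff.2 h2) n
      rw [Polynomial.eval_mul, Polynomial.eval_pow, Polynomial.eval_X, norm_mul, norm_pow,
        norm_pow, pow_succ] at h1
      refine le_of_mul_le_mul_left (a := ‖δ‖ ^ n) ?_ h3
      linarith
    have h0 : q.eval 0 = 0 := tendsto_nhds_unique
      ((q.continuous.tendsto 0).mono_left nhdsWithin_le_nhds)
      (hq.trans_tendsto (tendsto_id.mono_left nhdsWithin_le_nhds))
    obtain ⟨q', rfl⟩ : Polynomial.X ∣ q := by
      rwa [Polynomial.X_dvd_iff, Polynomial.coeff_zero_eq_eval_zero]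
    exact ⟨q', by ring⟩

/-- If a polynomial family is `O(δⁿ)` at every point, then so are its derivatives. -/
theorem IsPolynomialFamily.fderiv_isBigO {f : ℝ → E → ℝ} (hf : IsPolynomialFamily f) {n : ℕ}
    (h : ∀ x, (fun δ => f δ x) =O[𝓝 0] fun δ : ℝ => δ ^ n) (x v : E) :
    (fun δ => fderiv ℝ (f δ) x v) =O[𝓝 0] fun δ : ℝ => δ ^ n := by
  obtain ⟨P, hP⟩ := hf
  -- The estimate is not uniform in the point and could not be differentiated as such. Being
  -- polynomial in `δ`, it says that the low coefficients vanish identically as functions of the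
  -- point, and so do their derivatives.
  have hcoeff : ∀ j < n, P.coeff j = 0 := by
    intro j hj
    ext y
    have h1 : Polynomial.X ^ n ∣ P.map (evalHom y) := X_pow_dvd_of_isBigO n (by
      have := h y
      simpa only [hP, Polynomial.eval_map] using this)
    have h2 := Polynomial.X_pow_dvd_iff.1 h1 j hj
    rw [Polynomial.coeff_map] at h2
    exact h2
  have hfd : ∀ δ, fderiv ℝ (f δ) x v = ∑ j ∈ Finset.range (P.natDegree + 1),
      fderiv ℝ (P.coeff j : E → ℝ) x v * δ ^ j := by
    intro δ
    have hd : HasFDerivAt (f δ) (∑ j ∈ Finset.range (P.natDegree + 1),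
        δ ^ j • fderiv ℝ (P.coeff j : E → ℝ) x) x := by
      have h3 : f δ = fun y => ∑ j ∈ Finset.range (P.natDegree + 1),
          δ ^ j * (P.coeff j : E → ℝ) y := by
        ext y
        rw [hP, Polynomial.eval₂_eq_sum_range]
        exact Finset.sum_congr rfl fun j _ => mul_comm _ _
      rw [h3]
      exact HasFDerivAt.fun_sum fun j _ => ((P.coeff j).2 x).hasFDerivAt.const_mul (δ ^ j)
    rw [hd.fderiv, sum_apply]
    exact Finset.sum_congr rfl fun j _ => by simp [mul_comm]
  simp only [hfd]
  refine IsBigO.fun_sum fun j _ => ?_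
  rcases lt_or_ge j n with hj | hj
  · rw [hcoeff j hj]
    simp [isBigO_zero]
  · exact (pow_isBigO_pow hj).const_mul_left _

end PolynomialFamilies

/-! ### Trace invariance and finiteness for polynomial normal forms -/

section PolynomialNormalForms

open Asymptotics Filter

theorem contDiff_eval_mvPolynomial {σ : Type*} [Fintype σ] (p : MvPolynomial σ ℝ) :
    ContDiff ℝ ∞ fun x : σ → ℝ => MvPolynomial.eval x p := by
  induction p using MvPolynomial.induction_on with
  | C a => simpa using contDiff_const
  | add p q hp hq => simpa using hp.add hq
  | mul_X p i hp => simpa using hp.mul (contDiff_apply ℝ ℝ i)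

theorem IsPolynomialField.mem_smoothFields {n : ℕ} {f : (Fin n → ℝ) → (Fin n → ℝ)}
    (hf : IsPolynomialField f) : f ∈ smoothFields n := by
  obtain ⟨⟨P, hP⟩, h0⟩ := hf
  refine ⟨contDiff_pi.2 fun i => ?_, h0⟩
  simpa only [hP] using contDiff_eval_mvPolynomial (P i)

theorem IsPolynomialField.exists_polynomial {f : (Fin 2 → ℝ) → (Fin 2 → ℝ)}
    (hf : IsPolynomialField f) : ∃ P : Polynomial ℝ, ∀ s, f ![s, 0] 0 = P.eval s := by
  obtain ⟨⟨P, hP⟩, -⟩ := hf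
  refine ⟨MvPolynomial.aeval ![Polynomial.X, 0] (P 0), fun s => ?_⟩
  rw [hP]
  generalize P 0 = p
  induction p using MvPolynomial.induction_on with
  | C a => simp
  | add p q hp hq => simp [hp, hq]
  | mul_X p i hp => rw [map_mul, map_mul, Polynomial.eval_mul, hp]; fin_cases i <;> simp

/-- `A` is skew, so the operators of `A` and `A*` differ only by a sign. -/
theorem homological_eq_zero_of_transpose {f : (Fin 2 → ℝ) → (Fin 2 → ℝ)}
    (h : homological exampleMatrixᵀ f = 0) : homological exampleMatrix f = 0 := by
  funext x
  have := congrFun h x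
  rw [exampleMatrix_transpose] at this
  simp only [homological, Matrix.neg_mulVec, map_neg, Pi.zero_apply] at this ⊢
  rw [← neg_eq_zero, ← this]
  abel

/-- The determinant of a near identity transformation transfers a conjugacy defect to traces. -/
theorem det_mul_trace_sub (M S B : Matrix (Fin 2) (Fin 2) ℝ) :
    M.det * (S.trace - B.trace) = M 1 1 * (M * S - B * M) 0 0 - M 0 1 * (M * S - B * M) 1 0
      - M 1 0 * (M * S - B * M) 0 1 + M 0 0 * (M * S - B * M) 1 1 := by
  -- The right-hand side is the trace of `adj(M) (M S - B M)`.
  simp only [Matrix.det_fin_two, Matrix.trace_fin_two, Matrix.sub_apply, Matrix.mul_apply,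
    Fin.sum_univ_two]
  ring

/-- The Jacobian matrix at the origin. -/
noncomputable def jacobian (f : (Fin 2 → ℝ) → (Fin 2 → ℝ)) : Matrix (Fin 2) (Fin 2) ℝ :=
  LinearMap.toMatrix' (fderiv ℝ f 0 : (Fin 2 → ℝ) →ₗ[ℝ] (Fin 2 → ℝ))

theorem jacobian_apply (f : (Fin 2 → ℝ) → (Fin 2 → ℝ)) (i j : Fin 2) :
    jacobian f i j = fderiv ℝ f 0 (Pi.single j 1) i := by
  simp [jacobian, LinearMap.toMatrix'_apply]

theorem jacobian_mul_apply (f g : (Fin 2 → ℝ) → (Fin 2 → ℝ)) (i j : Fin 2) :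
    (jacobian f * jacobian g) i j = fderiv ℝ f 0 (fderiv ℝ g 0 (Pi.single j 1)) i := by
  rw [jacobian, jacobian, ← LinearMap.toMatrix'_comp]
  simp [LinearMap.toMatrix'_apply]

variable {m : ℕ} {R h : ℕ → (Fin 2 → ℝ) → (Fin 2 → ℝ)}

theorem hasFDerivAt_truncatedField (A : Matrix (Fin 2) (Fin 2) ℝ)
    (hR : ∀ k < m, R k ∈ smoothFields 2) (δ : ℝ) (x : Fin 2 → ℝ) :
    HasFDerivAt (truncatedField A R m δ)
      (LinearMap.toContinuousLinearMap (Matrix.mulVecLin A)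
        + ∑ k ∈ Finset.range m, δ ^ (k + 1) • fderiv ℝ (R k) x) x := by
  refine (LinearMap.toContinuousLinearMap (Matrix.mulVecLin A)).hasFDerivAt.add ?_
  refine HasFDerivAt.fun_sum fun k hk => HasFDerivAt.fun_const_smul ?_ _
  exact ((hR k (Finset.mem_range.1 hk)).1.differentiable (by simp) x).hasFDerivAt

theorem hasFDerivAt_nearIdentity (hh : ∀ k < m, h k ∈ smoothFields 2) (δ : ℝ) (x : Fin 2 → ℝ) :
    HasFDerivAt (nearIdentity h m δ)
      (ContinuousLinearMap.id ℝ _ + ∑ k ∈ Finset.range m, δ ^ (k + 1) • fderiv ℝ (h k) x) x := by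
  refine (hasFDerivAt_id x).add ?_
  refine HasFDerivAt.fun_sum fun k hk => HasFDerivAt.fun_const_smul ?_ _
  exact ((hh k (Finset.mem_range.1 hk)).1.differentiable (by simp) x).hasFDerivAt

theorem contDiff_nearIdentity (hh : ∀ k < m, h k ∈ smoothFields 2) (δ : ℝ) :
    ContDiff ℝ ∞ (nearIdentity h m δ) :=
  contDiff_id.add (ContDiff.sum fun k hk => (hh k (Finset.mem_range.1 hk)).1.const_smul _)

theorem truncatedField_zero (A : Matrix (Fin 2) (Fin 2) ℝ)
    (hR : ∀ k < m, R k ∈ smoothFields 2) (δ : ℝ) : truncatedField A R m δ 0 = 0 := by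
  rw [truncatedField, Matrix.mulVec_zero, zero_add]
  exact Finset.sum_eq_zero fun k hk => by rw [(hR k (Finset.mem_range.1 hk)).2, smul_zero]

theorem nearIdentity_zero (hh : ∀ k < m, h k ∈ smoothFields 2) (δ : ℝ) :
    nearIdentity h m δ 0 = 0 := by
  rw [nearIdentity, zero_add]
  exact Finset.sum_eq_zero fun k hk => by rw [(hh k (Finset.mem_range.1 hk)).2, smul_zero]

theorem exampleTaylorTerm_mem (ε : ℝ) (k : ℕ) : exampleTaylorTerm ε k ∈ smoothFields 2 := by
  refine ⟨contDiff_pi.2 fun i => ?_, ?_⟩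
  · fin_cases i
    · change ContDiff ℝ ∞ fun x : Fin 2 → ℝ =>
        2 * ε * ((-1) ^ k * x 0 ^ (2 * k + 1) / ((2 * k + 1).factorial : ℝ))
      fun_prop
    · exact contDiff_const
  · ext i
    fin_cases i <;> simp [exampleTaylorTerm]

theorem jacobian_trace_exampleTaylorTerm (ε : ℝ) (k : ℕ) :
    (jacobian (exampleTaylorTerm ε k)).trace = if k = 0 then 2 * ε else 0 := by
  have hd := ((exampleTaylorTerm_mem ε k).1.differentiable (by simp) 0).hasFDerivAt
  have h1 : jacobian (exampleTaylorTerm ε k) 1 1 = 0 := by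
    rw [jacobian_apply]
    have h2 := hasFDerivAt_pi'.1 hd 1
    have h3 : HasFDerivAt (fun x => exampleTaylorTerm ε k x 1)
        (0 : (Fin 2 → ℝ) →L[ℝ] ℝ) 0 := hasFDerivAt_const (0 : ℝ) _
    simpa using congrArg (fun T : (Fin 2 → ℝ) →L[ℝ] ℝ => T (Pi.single 1 1)) (h2.unique h3)
  have h0 : jacobian (exampleTaylorTerm ε k) 0 0 = if k = 0 then 2 * ε else 0 := by
    rw [jacobian_apply]
    have hline : HasDerivAt (fun s : ℝ => s • (Pi.single 0 1 : Fin 2 → ℝ)) (Pi.single 0 1) 0 := by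
      simpa using (hasDerivAt_id (0 : ℝ)).smul_const (Pi.single 0 1 : Fin 2 → ℝ)
    have hd' : HasFDerivAt (exampleTaylorTerm ε k) (fderiv ℝ (exampleTaylorTerm ε k) 0)
        ((0 : ℝ) • (Pi.single 0 1 : Fin 2 → ℝ)) := by rwa [zero_smul]
    have h2 := hasDerivAt_pi.1 (hd'.comp_hasDerivAt (0 : ℝ) hline) 0
    have h3 := ((((hasDerivAt_pow (2 * k + 1) (0 : ℝ)).const_mul ((-1) ^ k)).div_const
      ((2 * k + 1).factorial : ℝ)).const_mul (2 * ε))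
    have h4 : (fun s : ℝ => (exampleTaylorTerm ε k ∘ fun s : ℝ =>
        s • (Pi.single 0 1 : Fin 2 → ℝ)) s 0) =
        fun s => 2 * ε * ((-1) ^ k * s ^ (2 * k + 1) / ((2 * k + 1).factorial : ℝ)) := by
      ext s
      simp [exampleTaylorTerm]
    rw [h4] at h2
    rw [h2.unique h3]
    rcases eq_or_ne k 0 with rfl | hk
    · simp
    · simp [hk]
  rw [Matrix.trace_fin_two, h0, h1, add_zero]

theorem isPolynomialFamily_truncatedField (A : Matrix (Fin 2) (Fin 2) ℝ)
    (hR : ∀ k < m, R k ∈ smoothFields 2) (i : Fin 2) :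
    IsPolynomialFamily fun δ x => truncatedField A R m δ x i := by
  have h1 : ∀ δ x, truncatedField A R m δ x i =
      (A *ᵥ x) i + ∑ k ∈ Finset.range m, δ ^ (k + 1) * R k x i := fun δ x => by
    simp [truncatedField, Finset.sum_apply]
  simp only [h1]
  refine (IsPolynomialFamily.of_differentiable ?_).add
    (IsPolynomialFamily.sum _ fun k hk => (IsPolynomialFamily.pow_param _).mul
      (IsPolynomialFamily.of_differentiable ?_))
  · exact differentiable_pi.1 ((contDiff_mulVec A).differentiable (by simp)) i
  · exact differentiable_pi.1 ((hR k (Finset.mem_range.1 hk)).1.differentiable (by simp)) i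

theorem isPolynomialFamily_nearIdentity (hh : ∀ k < m, h k ∈ smoothFields 2) (i : Fin 2) :
    IsPolynomialFamily fun δ x => nearIdentity h m δ x i := by
  have h1 : ∀ δ x, nearIdentity h m δ x i =
      x i + ∑ k ∈ Finset.range m, δ ^ (k + 1) * h k x i := fun δ x => by
    simp [nearIdentity, Finset.sum_apply]
  simp only [h1]
  refine (IsPolynomialFamily.of_differentiable (differentiable_apply i)).add
    (IsPolynomialFamily.sum _ fun k hk => (IsPolynomialFamily.pow_param _).mul
      (IsPolynomialFamily.of_differentiable ?_))
  exact differentiable_pi.1 ((hh k (Finset.mem_range.1 hk)).1.differentiable (by simp)) i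

theorem isPolynomialFamily_fderiv_nearIdentity (hh : ∀ k < m, h k ∈ smoothFields 2)
    {w : ℝ → (Fin 2 → ℝ) → (Fin 2 → ℝ)} (hw : ∀ j, IsPolynomialFamily fun δ x => w δ x j)
    (i : Fin 2) :
    IsPolynomialFamily fun δ x => fderiv ℝ (nearIdentity h m δ) x (w δ x) i := by
  have h1 : ∀ δ x, fderiv ℝ (nearIdentity h m δ) x (w δ x) i = w δ x i +
      ∑ k ∈ Finset.range m, δ ^ (k + 1) *
        ∑ j, w δ x j * fderiv ℝ (h k) x (Pi.single j 1) i := fun δ x => by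
    rw [(hasFDerivAt_nearIdentity hh δ x).fderiv]
    simp only [add_apply, sum_apply, Finset.sum_apply, Pi.add_apply, ContinuousLinearMap.id_apply,
      smul_apply, Pi.smul_apply, smul_eq_mul]
    congr 1
    refine Finset.sum_congr rfl fun k _ => congrArg _ ?_
    have hv : w δ x = w δ x 0 • Pi.single 0 1 + w δ x 1 • Pi.single 1 1 := by
      ext j
      fin_cases j <;> simp
    conv_lhs => rw [hv, map_add, map_smul, map_smul]
    simp [Fin.sum_univ_two]
  simp only [h1]
  refine (hw i).add (IsPolynomialFamily.sum _ fun k hk => (IsPolynomialFamily.pow_param _).mul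
    (IsPolynomialFamily.sum _ fun j _ => (hw j).mul (IsPolynomialFamily.of_differentiable ?_)))
  have h2 : ContDiff ℝ ∞ (fderiv ℝ (h k)) :=
    (hh k (Finset.mem_range.1 hk)).1.fderiv_right (by simp)
  exact differentiable_pi.1 ((h2.clm_apply contDiff_const).differentiable (by simp)) i

theorem isPolynomialFamily_truncatedField_nearIdentity (ε : ℝ)
    (hh : ∀ k < m, h k ∈ smoothFields 2) (i : Fin 2) :
    IsPolynomialFamily fun δ x => truncatedField exampleMatrix (exampleTaylorTerm ε) m δ
      (nearIdentity h m δ x) i := by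
  have hn := isPolynomialFamily_nearIdentity hh
  have hc : ∀ c : ℝ, IsPolynomialFamily fun (_ : ℝ) (_ : Fin 2 → ℝ) => c := fun c =>
    IsPolynomialFamily.of_differentiable (differentiable_const c)
  fin_cases i
  · have h1 : ∀ δ x, truncatedField exampleMatrix (exampleTaylorTerm ε) m δ
        (nearIdentity h m δ x) 0 = nearIdentity h m δ x 1 + ∑ k ∈ Finset.range m, δ ^ (k + 1) *
          ((2 * ε * (-1) ^ k / ((2 * k + 1).factorial : ℝ)) *
            nearIdentity h m δ x 0 ^ (2 * k + 1)) := fun δ x => by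
      simp only [truncatedField, exampleMatrix_mulVec, Pi.add_apply, Finset.sum_apply,
        Pi.smul_apply, smul_eq_mul, exampleTaylorTerm, Matrix.cons_val_zero]
      congr 1
      exact Finset.sum_congr rfl fun k _ => by ring
    simp only [Fin.zero_eta, h1]
    exact (hn 1).add (IsPolynomialFamily.sum _ fun k _ => (IsPolynomialFamily.pow_param _).mul
      ((hc _).mul ((hn 0).pow _)))
  · have h1 : ∀ δ x, truncatedField exampleMatrix (exampleTaylorTerm ε) m δ
        (nearIdentity h m δ x) 1 = 0 - nearIdentity h m δ x 0 := fun δ x => by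
      simp [truncatedField, exampleMatrix, Finset.sum_apply, exampleTaylorTerm, Matrix.vecHead]
    simp only [Fin.mk_one, h1]
    exact (hc 0).sub (hn 0)

theorem jacobian_nearIdentity (hh : ∀ k < m, h k ∈ smoothFields 2) (δ : ℝ) (i j : Fin 2) :
    jacobian (nearIdentity h m δ) i j = (Pi.single j 1 : Fin 2 → ℝ) i +
      ∑ k ∈ Finset.range m, δ ^ (k + 1) * jacobian (h k) i j := by
  simp [jacobian_apply, (hasFDerivAt_nearIdentity hh δ 0).fderiv, sum_apply, Finset.sum_apply]

theorem jacobian_trace_truncatedField (hR : ∀ k < m, R k ∈ smoothFields 2) (δ : ℝ) :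
    (jacobian (truncatedField exampleMatrix R m δ)).trace =
      ∑ k ∈ Finset.range m, δ ^ (k + 1) * (jacobian (R k)).trace := by
  simp only [Matrix.trace_fin_two, jacobian_apply,
    (hasFDerivAt_truncatedField exampleMatrix hR δ 0).fderiv, add_apply, sum_apply,
    Finset.sum_apply, Pi.add_apply, smul_apply, Pi.smul_apply, smul_eq_mul, mul_add,
    Finset.sum_add_distrib]
  simp [exampleMatrix]

/-- The traces of the linear parts are invariant under near identity transformations. -/
theorem jacobian_trace_eq_of_normalForm {ε : ℝ}
    (hR : ∀ k < m, R k ∈ smoothFields 2) (hh : ∀ k < m, h k ∈ smoothFields 2)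
    (hO : ∀ z, (fun δ : ℝ => fderiv ℝ (nearIdentity h m δ) z (truncatedField exampleMatrix R m δ z)
        - truncatedField exampleMatrix (exampleTaylorTerm ε) m δ (nearIdentity h m δ z))
          =O[𝓝 0] fun δ : ℝ => δ ^ (m + 1)) :
    ∀ k < m, (jacobian (R k)).trace = (jacobian (exampleTaylorTerm ε k)).trace := by
  have hg : ∀ k < m, exampleTaylorTerm ε k ∈ smoothFields 2 := fun k _ => exampleTaylorTerm_mem ε k
  set M := fun δ => jacobian (nearIdentity h m δ)
  set S := fun δ => jacobian (truncatedField exampleMatrix R m δ)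
  set B := fun δ => jacobian (truncatedField exampleMatrix (exampleTaylorTerm ε) m δ)
  -- The conjugacy defect is differentiated at the origin; the second derivative of the
  -- transformation drops out because the fields vanish there.
  have hL : ∀ i j, (fun δ => (M δ * S δ - B δ * M δ) i j) =O[𝓝 0] fun δ : ℝ => δ ^ (m + 1) := by
    intro i j
    have hfam := (isPolynomialFamily_fderiv_nearIdentity hh
      (isPolynomialFamily_truncatedField exampleMatrix hR) i).sub
      (isPolynomialFamily_truncatedField_nearIdentity ε hh i)
    have hder := hfam.fderiv_isBigO (n := m + 1) (fun x => (isBigO_pi.1 (hO x)) i) 0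
      (Pi.single j 1)
    refine hder.congr_left fun δ => ?_
    have hφ := contDiff_nearIdentity hh δ
    have hφ2 : ContDiff ℝ ∞ (fderiv ℝ (nearIdentity h m δ)) := hφ.fderiv_right (by simp)
    have hF := (hasFDerivAt_truncatedField exampleMatrix hR δ 0).differentiableAt.hasFDerivAt
    have hG := (hasFDerivAt_truncatedField exampleMatrix hg δ
      (nearIdentity h m δ 0)).differentiableAt.hasFDerivAt
    have h1 := ((hφ2.differentiable (by simp) 0).hasFDerivAt.clm_apply hF).sub
      (hG.comp 0 (hφ.differentiable (by simp) 0).hasFDerivAt)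
    have h2 := (hasFDerivAt_pi'.1 h1 i).fderiv
    rw [truncatedField_zero _ hR, nearIdentity_zero hh] at h2
    simp only [Matrix.sub_apply, M, S, B, jacobian_mul_apply]
    refine (congrArg (fun T : (Fin 2 → ℝ) →L[ℝ] ℝ => T (Pi.single j 1)) h2).trans ?_
    simp
  have hMc : ∀ i j, Continuous fun δ => M δ i j := fun i j => by
    simp only [M, jacobian_nearIdentity hh]
    fun_prop
  have hM1 : ∀ i j, (fun δ => M δ i j) =O[𝓝 0] fun _ => (1 : ℝ) := fun i j =>
    (hMc i j).continuousAt.tendsto.isBigO_one ℝ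
  have hmul : ∀ i j i' j', (fun δ => M δ i j * (M δ * S δ - B δ * M δ) i' j') =O[𝓝 0]
      fun δ : ℝ => δ ^ (m + 1) := fun i j i' j' => by
    simpa using (hM1 i j).mul (hL i' j')
  have hdet : Continuous fun δ => (M δ).det := by
    simp only [Matrix.det_fin_two]
    exact ((hMc 0 0).mul (hMc 1 1)).sub ((hMc 0 1).mul (hMc 1 0))
  have hdet0 : (M 0).det = 1 := by
    simp [M, Matrix.det_fin_two, jacobian_nearIdentity hh]
  have hT : (fun δ => (S δ).trace - (B δ).trace) =O[𝓝 0] fun δ : ℝ => δ ^ (m + 1) := by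
    have h1 : (fun δ => (M δ).det * ((S δ).trace - (B δ).trace)) =O[𝓝 0]
        fun δ : ℝ => δ ^ (m + 1) := by
      simp only [det_mul_trace_sub]
      exact (((hmul 1 1 0 0).sub (hmul 0 1 1 0)).sub (hmul 1 0 0 1)).add (hmul 0 0 1 1)
    have hne : (M 0).det ≠ 0 := by rw [hdet0]; exact one_ne_zero
    have h2 : (fun δ => ((M δ).det)⁻¹) =O[𝓝 0] fun _ => (1 : ℝ) :=
      (hdet.continuousAt.inv₀ hne).tendsto.isBigO_one ℝ
    have h3 := h2.mul h1
    simp only [one_mul] at h3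
    refine h3.congr' ?_ EventuallyEq.rfl
    filter_upwards [hdet.continuousAt.eventually_ne hne] with δ hδ
    rw [inv_mul_cancel_left₀ hδ]
  -- The trace difference has degree at most `m` in `δ` but is `O(δ^{m+1})`, so every coefficient
  -- vanishes.
  set q : Polynomial ℝ := ∑ k ∈ Finset.range m, Polynomial.C
    ((jacobian (R k)).trace - (jacobian (exampleTaylorTerm ε k)).trace) * Polynomial.X ^ (k + 1)
    with hq
  have hqT : ∀ δ, q.eval δ = (S δ).trace - (B δ).trace := fun δ => by
    simp only [hq, S, B, jacobian_trace_truncatedField hR, jacobian_trace_truncatedField hg,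
      ← Finset.sum_sub_distrib, Polynomial.eval_finsetSum, Polynomial.eval_mul, Polynomial.eval_C,
      Polynomial.eval_pow, Polynomial.eval_X]
    exact Finset.sum_congr rfl fun k _ => by ring
  have hdvd := X_pow_dvd_of_isBigO (p := q) (m + 1) (by simpa only [hqT] using hT)
  intro k hk
  have h1 := Polynomial.X_pow_dvd_iff.1 hdvd (k + 1) (by omega)
  simp only [hq, Polynomial.finsetSum_coeff, Polynomial.coeff_C_mul, Polynomial.coeff_X_pow,
    add_left_inj, mul_ite, mul_one, mul_zero, Finset.sum_ite_eq, Finset.mem_range, hk,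
    if_true] at h1
  linarith

/-- `A` is itself the quarter turn `rot (π / 2)`, so the derivative at `0` commutes with it and has
equal diagonal entries. The trace then determines the radial linear coefficient. -/
theorem jacobian_apply_one_one {f : (Fin 2 → ℝ) → (Fin 2 → ℝ)} (hf : Differentiable ℝ f)
    (h0 : homological exampleMatrix f = 0) : jacobian f 1 1 = jacobian f 0 0 := by
  have hrot : ∀ x, rot (Real.pi / 2) x = exampleMatrix *ᵥ x := fun x => by simp [rot]
  set A := LinearMap.toContinuousLinearMap (Matrix.mulVecLin exampleMatrix)
  have hA : ∀ x, A x = exampleMatrix *ᵥ x := fun x => rfl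
  have hcomm : f ∘ A = A ∘ f := funext fun x => by
    have := apply_rot_of_homological_eq_zero hf h0 (Real.pi / 2) x
    rwa [hrot, hrot] at this
  have h1 : HasFDerivAt (f ∘ A) ((fderiv ℝ f 0).comp A) 0 := by
    refine HasFDerivAt.comp 0 ?_ A.hasFDerivAt
    rw [map_zero]
    exact (hf 0).hasFDerivAt
  have h2 : HasFDerivAt (A ∘ f) (A.comp (fderiv ℝ f 0)) 0 :=
    A.hasFDerivAt.comp 0 (hf 0).hasFDerivAt
  rw [hcomm] at h1
  have h3 := congrFun (congrArg (fun T : (Fin 2 → ℝ) →L[ℝ] (Fin 2 → ℝ) => T (Pi.single 0 1))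
    (h1.unique h2)) 1
  simp only [ContinuousLinearMap.comp_apply, hA, exampleMatrix_mulVec] at h3
  have h4 : (![(Pi.single 0 1 : Fin 2 → ℝ) 1, -(Pi.single 0 1 : Fin 2 → ℝ) 0] : Fin 2 → ℝ) =
      -Pi.single 1 1 := by
    ext i
    fin_cases i <;> simp
  rw [h4, map_neg] at h3
  simp only [jacobian_apply]
  simpa using h3

/-- Polynomial normal forms of the example have only finitely many periodic orbits. -/
theorem finite_periodicOrbits_polynomialNormalForm {ε δ : ℝ} (hε : 0 < ε) (hm : 1 ≤ m)
    (hδ : 0 < δ)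
    (hNF : IsPolynomialNormalForm exampleMatrix (exampleTaylorTerm ε) m R) :
    (periodicOrbits (truncatedField exampleMatrix R m δ)).Finite := by
  obtain ⟨hR, h, hh, hO⟩ := hNF
  have hRs : ∀ k < m, R k ∈ smoothFields 2 := fun k hk => (hR k hk).1.mem_smoothFields
  have hRd : ∀ k < m, Differentiable ℝ (R k) := fun k hk => (hRs k hk).1.differentiable (by simp)
  have hRh : ∀ k < m, homological exampleMatrix (R k) = 0 := fun k hk =>
    homological_eq_zero_of_transpose (hR k hk).2
  have htr := jacobian_trace_eq_of_normalForm hRs (fun k hk => (hh k hk).mem_smoothFields) hO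
  have hR00 : ∀ k < m, jacobian (R k) 0 0 = if k = 0 then ε else 0 := fun k hk => by
    have h1 := htr k hk
    rw [jacobian_trace_exampleTaylorTerm, Matrix.trace_fin_two,
      jacobian_apply_one_one (hRd k hk) (hRh k hk)] at h1
    split_ifs at h1 ⊢ <;> linarith
  choose! P hP using fun k (hk : k < m) => (hR k hk).1.exists_polynomial
  set Q : Polynomial ℝ := ∑ k ∈ Finset.range m, Polynomial.C (δ ^ (k + 1)) * P k with hQ
  have hQe : ∀ s, truncatedField exampleMatrix R m δ ![s, 0] 0 = Q.eval s := fun s => by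
    simp only [hQ, truncatedField, exampleMatrix_mulVec, Pi.add_apply, Finset.sum_apply,
      Pi.smul_apply, smul_eq_mul, Matrix.cons_val_zero, Matrix.cons_val_one, zero_add,
      Polynomial.eval_finsetSum, Polynomial.eval_mul, Polynomial.eval_C]
    exact Finset.sum_congr rfl fun k hk => by rw [hP k (Finset.mem_range.1 hk)]
  refine finite_periodicOrbits_of_equivariant (P := Q) (fun t x => ?_) ?_ hQe
  · have hsum : rot t (∑ k ∈ Finset.range m, δ ^ (k + 1) • R k x) =
        ∑ k ∈ Finset.range m, rot t (δ ^ (k + 1) • R k x) := map_sum (rotCLM t) _ _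
    rw [truncatedField, truncatedField, rot_add_vec, exampleMatrix_mulVec_rot, hsum]
    refine congrArg _ (Finset.sum_congr rfl fun k hk => ?_)
    have hk' := Finset.mem_range.1 hk
    rw [apply_rot_of_homological_eq_zero (hRd k hk') (hRh k hk'), rot_smul]
  -- If `Q` vanished, so would the derivative of the radial part along the first axis at `0`. That
  -- derivative is `δ ε`, only the index `k = 0` contributing.
  · intro hQ0
    have hline : HasDerivAt (fun s : ℝ => (![s, 0] : Fin 2 → ℝ)) (Pi.single 0 1) 0 := by
      refine hasDerivAt_pi.2 fun i => ?_
      fin_cases i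
      · exact hasDerivAt_id 0
      · exact hasDerivAt_const 0 0
    have hF := hasFDerivAt_truncatedField exampleMatrix hRs δ 0
    have h00 : (![(0 : ℝ), 0] : Fin 2 → ℝ) = 0 := by ext i; fin_cases i <;> rfl
    rw [← h00] at hF
    have h1 := hasDerivAt_pi.1 (hF.comp_hasDerivAt (0 : ℝ) hline) 0
    have h2 : (fun s : ℝ => (truncatedField exampleMatrix R m δ ∘
        fun s : ℝ => (![s, 0] : Fin 2 → ℝ)) s 0) = fun _ => 0 := funext fun s => by
      simp [hQe, hQ0]
    rw [h2, h00] at h1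
    have h3 := h1.unique (hasDerivAt_const 0 (0 : ℝ))
    simp only [add_apply, sum_apply, Finset.sum_apply, Pi.add_apply, smul_apply, Pi.smul_apply,
      smul_eq_mul, ← jacobian_apply] at h3
    rw [Finset.sum_congr rfl fun k hk => by rw [hR00 k (Finset.mem_range.1 hk)]] at h3
    simp [exampleMatrix, Nat.ne_of_gt hm, hε.ne', hδ.ne'] at h3

end PolynomialNormalForms

end SmoothNormalForm

theorem mainTheorem4 :
    (∃ hA : IsCompl (SmoothNormalForm.imageSpace SmoothNormalForm.exampleMatrix)
        (SmoothNormalForm.kernelSpace SmoothNormalForm.exampleMatrix),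
      -- the first-order normal form in polar coordinates
      (∀ (ε : ℝ) (r θ : ℝ → ℝ) (t : ℝ), DifferentiableAt ℝ r t → DifferentiableAt ℝ θ t →
        0 < r t →
        (HasDerivAt (fun s => SmoothNormalForm.polarPoint (r s) (θ s))
            (SmoothNormalForm.firstOrderNormalForm SmoothNormalForm.exampleMatrix hA
              SmoothNormalForm.examplePerturbation ε
              (SmoothNormalForm.polarPoint (r t) (θ t))) t ↔
          HasDerivAt r (ε * SmoothNormalForm.besselJ 1 (2 * r t)) t ∧ HasDerivAt θ 1 t)) ∧
      -- it has infinitely many periodic orbits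
      (∀ ε : ℝ, 0 < ε →
        (SmoothNormalForm.periodicOrbits
          (SmoothNormalForm.firstOrderNormalForm SmoothNormalForm.exampleMatrix hA
            SmoothNormalForm.examplePerturbation ε)).Infinite)) ∧
    -- the Bessel function has infinitely many positive zeros
    {r : ℝ | 0 < r ∧ SmoothNormalForm.besselJ 1 (2 * r) = 0}.Infinite ∧
    -- the system itself has infinitely many periodic orbits
    (∃ ε₀ : ℝ, 0 < ε₀ ∧ ∀ ε : ℝ, 0 < ε → ε < ε₀ →
      (SmoothNormalForm.periodicOrbits (SmoothNormalForm.exampleField ε)).Infinite) ∧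
    -- polynomial normal forms of any order have only finitely many periodic orbits
    (∀ (ε : ℝ) (m : ℕ) (R : ℕ → (Fin 2 → ℝ) → (Fin 2 → ℝ)) (δ : ℝ), 0 < ε → 1 ≤ m →
      SmoothNormalForm.IsPolynomialNormalForm SmoothNormalForm.exampleMatrix
        (SmoothNormalForm.exampleTaylorTerm ε) m R → 0 < δ →
      (SmoothNormalForm.periodicOrbits
        (SmoothNormalForm.truncatedField SmoothNormalForm.exampleMatrix R m δ)).Finite) := by
  refine ⟨⟨SmoothNormalForm.isCompl_imageSpace_kernelSpace, fun ε r θ t hr hθ h0 =>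
    SmoothNormalForm.hasDerivAt_polarPoint_iff _ ε r θ t hr hθ h0, fun ε _ =>
    SmoothNormalForm.infinite_periodicOrbits_firstOrderNormalForm _ ε⟩,
    SmoothNormalForm.infinite_zeros_besselJ_one,
    ⟨1 / 10, by norm_num, fun ε h0 h1 =>
      SmoothNormalForm.infinite_periodicOrbits_exampleField h0 h1.le⟩,
    fun ε m R δ hε hm hNF hδ =>
      SmoothNormalForm.finite_periodicOrbits_polynomialNormalForm hε hm hδ hNF⟩
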